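/- **Setting.** Let $M$ be a complex $n$-manifold and $\pi:E\to M$ a holomorphic vector bundle of rank $m$ with a holomorphic Lie algebroid structure: a holomorphic bundle map (anchor) $\rho:E\to T'M$ and a Lie bracket $[\cdot,\cdot]_E$ on (the sheaf of) holomorphic sections of $E$ with $[s_1,fs_2]_E=f[s_1,s_2]_E+\rho(s_1)(f)s_2$. Let $F:E\to\mathbb R_+$ be a complex Finsler function: smooth off the zero section, $F(z,\lambda u)=|\lambda|^2F(z,u)$ for $\lambda\in\mathbb C$, and with $h_{\alpha\bar\beta}=\partial^2F/\partial u^\alpha\partial\bar u^\beta$ positive definite off the zero section. Fix a complex chart $(z^k)$ of $M$ and a holomorphic frame $(e_\alpha)$ of $E$ on its domain $U$, and let $(z^k,u^\alpha)$ be the induced coordinates on $\pi^{-1}(U)$; everything below is on $\pi^{-1}(U)$ minus the zero section. Repeated indices are summed. Write $\rho(e_\alpha)=\rho^k_\alpha\,\partial/\partial z^k$, $[e_\alpha,e_\beta]_E=\mathcal C^{\gamma}_{\alpha\beta}e_\gamma$, $\partial_\alpha=\rho^k_\alpha\,\partial/\partial z^k$, $\dot\partial_\alpha=\partial/\partial u^\alpha$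 and $\dot\partial_{\bar\alpha}=\partial/\partial\bar u^\alpha$. The prolongation $\mathcal T'E=\{(e,v)\in E\times T'E:\rho(e)=\pi'_*(v)\}$, a bundle over $E$, has the frame $\mathcal Z_\alpha=(e_\alpha,\rho^k_\alpha\partial/\partial z^k)$, $\mathcal V_\alpha=(0,\partial/\partial u^\alpha)$. Its complexification $\mathcal TE=\mathcal T'E\oplus\overline{\mathcal T'E}$ is a complex Lie algebroid over $E$ with anchor $(e,v)\mapsto v$ (extended to conjugates) and with the bracket on smooth sections that satisfies the Leibniz rule and $[\mathcal Z_\alpha,\mathcal Z_\beta]=\mathcal C^\gamma_{\alpha\beta}\mathcal Z_\gamma$, $[\mathcal Z_{\bar\alpha},\mathcal Z_{\bar\beta}]=\overline{\mathcal C^\gamma_{\alpha\beta}}\mathcal Z_{\bar\gamma}$, all other brackets of the frame $\{\mathcal Z_\alpha,\mathcal V_\alpha,\mathcal Z_{\bar\alpha},\mathcal V_{\bar\alpha}\}$ being zero. Sections act on functions through the anchor. With $(h^{\bar\sigma\beta})$ the inverse matrix of $(h_{\alpha\bar\sigma})$ put $$N^\beta_\alpha=h^{\bar\sigma\beta}\partial_\alpha\dot\partial_{\bar\sigma}F,\qquad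 \delta_\alpha=\partial_\alpha-N^\beta_\alpha\dot\partial_\beta,\qquad \mathcal X_\alpha=\mathcal Z_\alpha-N^\beta_\alpha\mathcal V_\beta,$$ $$L^\gamma_{\alpha\beta}=h^{\bar\sigma\gamma}\delta_\beta(h_{\alpha\bar\sigma}),\qquad C^\gamma_{\alpha\beta}=h^{\bar\sigma\gamma}\dot\partial_\beta(h_{\alpha\bar\sigma}),$$ $$L_\alpha=L^\beta_{\alpha\beta}-L^\beta_{\beta\alpha},\qquad C_\alpha=C^\beta_{\alpha\beta},\qquad \mathcal C_\alpha=\mathcal C^\beta_{\alpha\beta},$$ and $\nabla_{\mathcal X_\gamma}T^\alpha=\delta_\gamma T^\alpha+T^\varepsilon L^\alpha_{\varepsilon\gamma}$, $\nabla_{\mathcal V_\gamma}T^\alpha=\dot\partial_\gamma T^\alpha+T^\varepsilon C^\alpha_{\varepsilon\gamma}$. Let $\{\mathcal Z^\alpha,\delta\mathcal V^\alpha\}$ be the coframe dual to $\{\mathcal X_\alpha,\mathcal V_\alpha\}$, let $\Phi=i\,h_{\alpha\bar\beta}(\mathcal Z^\alpha\wedge\mathcal Z^{\bar\beta}+\delta\mathcal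 V^\alpha\wedge\delta\mathcal V^{\bar\beta})$, and let $d\mathcal V=\frac1{(2m)!}\Phi^{2m}$ be the volume form. For a section $Z$ of $\mathcal TE$ the divergence $\operatorname{div}Z$ is the function defined by $\mathcal L_Z\,d\mathcal V=(\operatorname{div}Z)\,d\mathcal V$, where $(\mathcal L_Z\eta)(Y_1,\dots,Y_k)=Z(\eta(Y_1,\dots,Y_k))-\sum_j\eta(Y_1,\dots,[Z,Y_j],\dots,Y_k)$. **Proposition.** Let $Z=Z^\alpha\mathcal X_\alpha+V^\alpha\mathcal V_\alpha$ be a smooth section of $\mathcal T'E$. The divergences of $Z^h=Z^\alpha\mathcal X_\alpha$, $Z^v=V^\alpha\mathcal V_\alpha$ and $Z$ exist and are unique, $\operatorname{div}Z=\operatorname{div}^hZ+\operatorname{div}^vZ$ with $\operatorname{div}^hZ:=\operatorname{div}Z^h$, $\operatorname{div}^vZ:=\operatorname{div}Z^v$, and $$\operatorname{div}^hZ=\nabla_{\mathcal X_\alpha}Z^\alpha-Z^\alpha L_\alpha-Z^\alpha\mathcal C_\alpha,\qquad \operatorname{div}^vZ=\nabla_{\mathcal V_\alpha}V^\alpha+V^\alpha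 C_\alpha .$$ -/

import Mathlib

open scoped Manifold ContDiff Bundle ComplexOrder
open Bundle Complex

noncomputable section

namespace FinslerAlgebroid

section Global

variable (n m : ℕ)
  {M : Type*} [TopologicalSpace M] [ChartedSpace (Fin n → ℂ) M]
  [IsManifold 𝓘(ℂ, Fin n → ℂ) ω M]
  (E : M → Type*) [∀ x, AddCommGroup (E x)] [∀ x, Module ℂ (E x)] [∀ x, TopologicalSpace (E x)]
  [TopologicalSpace (TotalSpace (Fin m → ℂ) E)] [FiberBundle (Fin m → ℂ) E]

/-- The derivative at `x` of a holomorphic function `f` along the holomorphic tangent vector `v`. -/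
def holDeriv {n : ℕ} {M : Type*} [TopologicalSpace M] [ChartedSpace (Fin n → ℂ) M]
    (f : M → ℂ) (x : M) (v : TangentSpace 𝓘(ℂ, Fin n → ℂ) x) : ℂ :=
  mfderiv 𝓘(ℂ, Fin n → ℂ) 𝓘(ℂ, ℂ) f x v

/-- `s` is a holomorphic section of the bundle `E` (of rank `m`, over an `n`-dimensional complex
manifold) over the set `U`. -/
def IsHolSection {E : M → Type*} [TopologicalSpace (TotalSpace (Fin m → ℂ) E)]
    [∀ x, TopologicalSpace (E x)] [FiberBundle (Fin m → ℂ) E]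
    (s : ∀ x, E x) (U : Set M) : Prop :=
  ContMDiffOn 𝓘(ℂ, Fin n → ℂ) (𝓘(ℂ, Fin n → ℂ).prod 𝓘(ℂ, Fin m → ℂ)) ω
    (fun x => TotalSpace.mk' (Fin m → ℂ) x (s x)) U

/-- A holomorphic Lie algebroid structure on the holomorphic vector bundle `E → M`: a holomorphic
bundle map `ρ : E → T'M` (for a complex manifold `M`, the complex vector space `TangentSpace` of
Mathlib is the holomorphic tangent space), and a Lie bracket on the sheaf of holomorphic sections
of `E` which satisfies the Leibniz rule.  The bracket is a total function on set-theoretic sections;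
it is only meaningful on sections which are holomorphic on an open set, and it is local there. -/
structure HolLieAlgebroid where
  /-- the anchor `ρ` -/
  anchor : ∀ x, E x →ₗ[ℂ] TangentSpace 𝓘(ℂ, Fin n → ℂ) x
  anchor_hol : ∀ (U : Set M) (s : ∀ x, E x), IsOpen U → IsHolSection n m s U →
    ContMDiffOn 𝓘(ℂ, Fin n → ℂ) (𝓘(ℂ, Fin n → ℂ).tangent) ω
      (fun x => (⟨x, anchor x (s x)⟩ : TangentBundle 𝓘(ℂ, Fin n → ℂ) M)) U
  /-- the Lie bracket of local sections -/
  bracket : (∀ x, E x) → (∀ x, E x) → ∀ x, E x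
  bracket_hol : ∀ (U : Set M) (s t : ∀ x, E x), IsOpen U → IsHolSection n m s U →
    IsHolSection n m t U → IsHolSection n m (bracket s t) U
  bracket_local : ∀ (U : Set M) (s s' t t' : ∀ x, E x), IsOpen U → IsHolSection n m s U →
    IsHolSection n m t U → (∀ x ∈ U, s x = s' x) → (∀ x ∈ U, t x = t' x) →
    ∀ x ∈ U, bracket s t x = bracket s' t' x
  bracket_self : ∀ (U : Set M) (s : ∀ x, E x), IsOpen U → IsHolSection n m s U →
    ∀ x ∈ U, bracket s s x = 0
  bracket_add : ∀ (U : Set M) (s t r : ∀ x, E x), IsOpen U → IsHolSection n m s U →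
    IsHolSection n m t U → IsHolSection n m r U →
    ∀ x ∈ U, bracket s (fun y => t y + r y) x = bracket s t x + bracket s r x
  add_bracket : ∀ (U : Set M) (s t r : ∀ x, E x), IsOpen U → IsHolSection n m s U →
    IsHolSection n m t U → IsHolSection n m r U →
    ∀ x ∈ U, bracket (fun y => s y + t y) r x = bracket s r x + bracket t r x
  jacobi : ∀ (U : Set M) (s t r : ∀ x, E x), IsOpen U → IsHolSection n m s U →
    IsHolSection n m t U → IsHolSection n m r U →
    ∀ x ∈ U, bracket s (bracket t r) x + bracket t (bracket r s) x
      + bracket r (bracket s t) x = 0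
  leibniz : ∀ (U : Set M) (s t : ∀ x, E x) (f : M → ℂ), IsOpen U → IsHolSection n m s U →
    IsHolSection n m t U → ContMDiffOn 𝓘(ℂ, Fin n → ℂ) 𝓘(ℂ, ℂ) ω f U →
    ∀ x ∈ U, bracket s (fun y => f y • t y) x =
      f x • bracket s t x
        + holDeriv f x (anchor x (s x)) • t x

/-- A local coordinate system of `E`: a complex chart `(z^k)` of `M` together with a holomorphic
frame `(e_α)` of `E` over its domain. -/
structure LocalSystem where
  /-- the chart `(z^k)` -/
  chart : OpenPartialHomeomorph M (Fin n → ℂ)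
  chart_mem : chart ∈ IsManifold.maximalAtlas 𝓘(ℂ, Fin n → ℂ) ω M
  /-- the frame `(e_α)` -/
  frame : Fin m → ∀ x, E x
  isFrame : IsLocalFrameOn 𝓘(ℂ, Fin n → ℂ) (Fin m → ℂ) ω frame chart.source

end Global

/-- The space of the coordinates `(z, u)`. -/
abbrev Pt (n m : ℕ) : Type := (Fin n → ℂ) × (Fin m → ℂ)

/-- Indices of the natural frame `{𝒵_α, 𝒱_α, 𝒵_ᾱ, 𝒱_ᾱ}` of the complexified prolongation. -/
abbrev Idx (m : ℕ) : Type := (Fin m ⊕ Fin m) ⊕ (Fin m ⊕ Fin m)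

/-- the index of `𝒵_α` -/
abbrev iZ {m : ℕ} (α : Fin m) : Idx m := Sum.inl (Sum.inl α)
/-- the index of `𝒱_α` -/
abbrev iV {m : ℕ} (α : Fin m) : Idx m := Sum.inl (Sum.inr α)
/-- the index of `𝒵_ᾱ` -/
abbrev iZbar {m : ℕ} (α : Fin m) : Idx m := Sum.inr (Sum.inl α)
/-- the index of `𝒱_ᾱ` -/
abbrev iVbar {m : ℕ} (α : Fin m) : Idx m := Sum.inr (Sum.inr α)

/-- A section of the complexified prolongation `𝒯_ℂE`, in coordinates: its components in the
natural frame `{𝒵_α, 𝒱_α, 𝒵_ᾱ, 𝒱_ᾱ}`, as functions of `(z, u)`. -/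
abbrev Sec (n m : ℕ) : Type := Pt n m → Idx m → ℂ

section Wirtinger

variable {n m : ℕ}

/-- The derivative of `f` at `p` along the tangent vector of type `(1,0)` given by `v`. -/
def dHol (f : Pt n m → ℂ) (p v : Pt n m) : ℂ :=
  (fderiv ℝ f p v - I * fderiv ℝ f p (I • v)) / 2

/-- The derivative of `f` at `p` along the conjugate of the `(1,0)`-vector given by `v`. -/
def dAnti (f : Pt n m → ℂ) (p v : Pt n m) : ℂ :=
  (fderiv ℝ f p v + I * fderiv ℝ f p (I • v)) / 2

/-- `∂/∂z^k` -/
def dz (k : Fin n) (f : Pt n m → ℂ) (p : Pt n m) : ℂ := dHol f p (Pi.single k 1, 0)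
/-- `∂/∂u^α` -/
def du (α : Fin m) (f : Pt n m → ℂ) (p : Pt n m) : ℂ := dHol f p (0, Pi.single α 1)
/-- `∂/∂z̄^k` -/
def dzBar (k : Fin n) (f : Pt n m → ℂ) (p : Pt n m) : ℂ := dAnti f p (Pi.single k 1, 0)
/-- `∂/∂ū^α` -/
def duBar (α : Fin m) (f : Pt n m → ℂ) (p : Pt n m) : ℂ := dAnti f p (0, Pi.single α 1)

end Wirtinger

section Local

variable {n m : ℕ}
  {M : Type*} [TopologicalSpace M] [ChartedSpace (Fin n → ℂ) M]
  [IsManifold 𝓘(ℂ, Fin n → ℂ) ω M]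
  {E : M → Type*} [∀ x, AddCommGroup (E x)] [∀ x, Module ℂ (E x)] [∀ x, TopologicalSpace (E x)]
  [TopologicalSpace (TotalSpace (Fin m → ℂ) E)] [FiberBundle (Fin m → ℂ) E]

/-- The fibre at `p ∈ E` of the prolongation
`𝒯'E = {(e, v) ∈ E × T'E | ρ(e) = π'_*(v)}`, where `v` is tangent to `E` at `p`
and `e` lies in the fibre of `E` through `p`. -/
def prolongation (A : HolLieAlgebroid n m E) (p : TotalSpace (Fin m → ℂ) E) :
    Submodule ℂ (E p.proj ×
      TangentSpace (𝓘(ℂ, Fin n → ℂ).prod 𝓘(ℂ, Fin m → ℂ)) p) :=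
  LinearMap.eqLocus
    ((A.anchor p.proj).comp (LinearMap.fst ℂ _ _))
    ((mfderiv (𝓘(ℂ, Fin n → ℂ).prod 𝓘(ℂ, Fin m → ℂ)) 𝓘(ℂ, Fin n → ℂ)
      (TotalSpace.proj : TotalSpace (Fin m → ℂ) E → M) p).toLinearMap.comp
        (LinearMap.snd ℂ _ _))

/-- The range of the coordinates `(z, u)` on `E` with the zero section removed. -/
def LocalSystem.domain (S : LocalSystem n m E) : Set (Pt n m) :=
  {p | p.1 ∈ S.chart.target ∧ p.2 ≠ 0}

/-- The point `u^α e_α(z)` of `E` with coordinates `(z, u)`. -/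
def LocalSystem.point (S : LocalSystem n m E) (p : Pt n m) : TotalSpace (Fin m → ℂ) E :=
  ⟨S.chart.symm p.1, ∑ α, p.2 α • S.frame α (S.chart.symm p.1)⟩

/-- The coordinate function `u^α` on `E`. -/
def LocalSystem.coordU (S : LocalSystem n m E) (α : Fin m) (q : TotalSpace (Fin m → ℂ) E) : ℂ :=
  S.isFrame.coeff α q.proj q.2

/-- The anchor coefficients `ρ^k_α(z)`, `ρ(e_α) = ρ^k_α ∂/∂z^k`. -/
def anchorCoeff (A : HolLieAlgebroid n m E) (S : LocalSystem n m E) (k : Fin n) (α : Fin m)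
    (z : Fin n → ℂ) : ℂ :=
  (mfderiv 𝓘(ℂ, Fin n → ℂ) 𝓘(ℂ, Fin n → ℂ) S.chart (S.chart.symm z)
    (A.anchor (S.chart.symm z) (S.frame α (S.chart.symm z))) : Fin n → ℂ) k

/-- The structure functions `𝒞^γ_{αβ}(z)`, `[e_α, e_β] = 𝒞^γ_{αβ} e_γ`. -/
def structFn (A : HolLieAlgebroid n m E) (S : LocalSystem n m E) (γ α β : Fin m)
    (z : Fin n → ℂ) : ℂ :=
  S.isFrame.coeff γ (S.chart.symm z) (A.bracket (S.frame α) (S.frame β) (S.chart.symm z))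

/-- `∂_α = ρ^k_α ∂/∂z^k` -/
def dAlg (A : HolLieAlgebroid n m E) (S : LocalSystem n m E) (α : Fin m)
    (f : Pt n m → ℂ) (p : Pt n m) : ℂ :=
  ∑ k, anchorCoeff A S k α p.1 * dz k f p

/-- `∂_ᾱ`, the conjugate of `∂_α` -/
def dAlgBar (A : HolLieAlgebroid n m E) (S : LocalSystem n m E) (α : Fin m)
    (f : Pt n m → ℂ) (p : Pt n m) : ℂ :=
  ∑ k, (starRingEnd ℂ) (anchorCoeff A S k α p.1) * dzBar k f p

/-- A function on `E` in the coordinates `(z, u)`, with complex values. -/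
def LocalSystem.pull (S : LocalSystem n m E) (F : TotalSpace (Fin m → ℂ) E → ℝ)
    (p : Pt n m) : ℂ := (F (S.point p) : ℂ)

/-- The complex Finsler metric tensor `h_{αβ̄} = ∂²F/∂u^α∂ū^β`. -/
def metricTensor (F : TotalSpace (Fin m → ℂ) E → ℝ) (S : LocalSystem n m E)
    (p : Pt n m) : Matrix (Fin m) (Fin m) ℂ :=
  Matrix.of fun α β => du α (duBar β (S.pull F)) p

/-- A complex Finsler function on `E`: nonnegative, smooth off the zero section,
homogeneous, `F(z, λu) = |λ|² F(z, u)`, and strictly pseudoconvex: the metric tensor `h_{αβ̄}` is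
positive definite off the zero section. -/
structure IsFinsler (n : ℕ) {m : ℕ} {M : Type*} [TopologicalSpace M] [ChartedSpace (Fin n → ℂ) M]
  [IsManifold 𝓘(ℂ, Fin n → ℂ) ω M]
    {E : M → Type*} [∀ x, AddCommGroup (E x)] [∀ x, Module ℂ (E x)]
    [∀ x, TopologicalSpace (E x)]
    [TopologicalSpace (TotalSpace (Fin m → ℂ) E)] [FiberBundle (Fin m → ℂ) E]
    (F : TotalSpace (Fin m → ℂ) E → ℝ) : Prop where
  nonneg : ∀ q, 0 ≤ F q
  homogeneous : ∀ (x : M) (u : E x) (c : ℂ), F ⟨x, c • u⟩ = ‖c‖ ^ 2 * F ⟨x, u⟩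
  smooth : ∀ S : LocalSystem n m E, ContDiffOn ℝ ∞ (fun p => F (S.point p)) S.domain
  pseudoconvex : ∀ S : LocalSystem n m E, ∀ p ∈ S.domain, (metricTensor F S p).PosDef

variable (A : HolLieAlgebroid n m E) (F : TotalSpace (Fin m → ℂ) E → ℝ) (S : LocalSystem n m E)

/-- The inverse `h^{σ̄β}` of the metric tensor, `h_{ασ̄} h^{σ̄β} = δ_α^β`. -/
def metricInv (σ β : Fin m) (p : Pt n m) : ℂ := (metricTensor F S p)⁻¹ σ β

/-- The function `h = det (h_{αβ̄})`. -/
def metricDet (p : Pt n m) : ℂ := (metricTensor F S p).det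

/-- The coefficients `N^β_α = h^{σ̄β} ∂_α ∂̇_σ̄ F` of the Chern-Finsler nonlinear connection. -/
def nonlin (β α : Fin m) (p : Pt n m) : ℂ :=
  ∑ σ, metricInv F S σ β p * dAlg A S α (duBar σ (S.pull F)) p

/-- `δ_α = ∂_α - N^β_α ∂̇_β` -/
def delta (α : Fin m) (f : Pt n m → ℂ) (p : Pt n m) : ℂ :=
  dAlg A S α f p - ∑ β, nonlin A F S β α p * du β f p

/-- `L^γ_{αβ} = h^{σ̄γ} δ_β(h_{ασ̄})` -/
def chernL (γ α β : Fin m) (p : Pt n m) : ℂ :=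
  ∑ σ, metricInv F S σ γ p * delta A F S β (fun q => metricTensor F S q α σ) p

/-- `C^γ_{αβ} = h^{σ̄γ} ∂̇_β(h_{ασ̄})` -/
def chernC (γ α β : Fin m) (p : Pt n m) : ℂ :=
  ∑ σ, metricInv F S σ γ p * du β (fun q => metricTensor F S q α σ) p

/-- Components of `∇_{𝒳_γ} T^α`, for a horizontal vector with components `T^α`. -/
def covH (T : Fin m → Pt n m → ℂ) (γ α : Fin m) (p : Pt n m) : ℂ :=
  delta A F S γ (T α) p + ∑ ε, T ε p * chernL A F S α ε γ p

/-- Components of `∇_{𝒱_γ} T^α`, for a vertical vector with components `T^α`. -/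
def covV (T : Fin m → Pt n m → ℂ) (γ α : Fin m) (p : Pt n m) : ℂ :=
  du γ (T α) p + ∑ ε, T ε p * chernC F S α ε γ p

/-- `L_α = L^β_{αβ} - L^β_{βα}` -/
def traceL (α : Fin m) (p : Pt n m) : ℂ :=
  ∑ β, (chernL A F S β α β p - chernL A F S β β α p)

/-- `C_α = C^β_{αβ}` -/
def traceC (α : Fin m) (p : Pt n m) : ℂ := ∑ β, chernC F S β α β p

/-- `𝒞_α = 𝒞^β_{αβ}` -/
def traceStruct (α : Fin m) (p : Pt n m) : ℂ := ∑ β, structFn A S β α β p.1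

/-- The section `𝒳_α = 𝒵_α - N^β_α 𝒱_β` of the adapted frame. -/
def secX (α : Fin m) : Sec n m := fun p =>
  Pi.single (iZ α) 1 - ∑ β, nonlin A F S β α p • Pi.single (iV β) 1

/-- The section `𝒱_α` of the adapted frame. -/
def secV (α : Fin m) : Sec n m := fun _ => Pi.single (iV α) 1

variable {A} in
/-- A section of `𝒯'E`, in coordinates: the section `(e, v)` has the `𝒵_α`-component `e^α` and the
`𝒱_α`-component `du^α(v)`. -/
def toSec (Z : ∀ q : TotalSpace (Fin m → ℂ) E, prolongation A q) : Sec n m := fun p =>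
  Sum.elim
    (Sum.elim
      (fun α => S.isFrame.coeff α (S.point p).proj (Z (S.point p)).1.1)
      (fun α => (mfderiv (𝓘(ℂ, Fin n → ℂ).prod 𝓘(ℂ, Fin m → ℂ)) 𝓘(ℂ, ℂ)
        (S.coordU α) (S.point p) (Z (S.point p)).1.2 : ℂ)))
    (fun _ => 0)

/-- The derivative of the function `f` along the section `Y` of `𝒯_ℂE`, that is, `ρ_𝒯(Y) f`. -/
def act (Y : Sec n m) (f : Pt n m → ℂ) (p : Pt n m) : ℂ :=
  ∑ α, (Y p (iZ α) * dAlg A S α f p + Y p (iV α) * du α f p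
    + Y p (iZbar α) * dAlgBar A S α f p + Y p (iVbar α) * duBar α f p)

/-- The coefficients of the brackets of the natural frame of `𝒯_ℂE`:
`[𝒵_α, 𝒵_β] = 𝒞^γ_{αβ} 𝒵_γ`, `[𝒵_ᾱ, 𝒵_β̄]` is its conjugate, and the other brackets vanish. -/
def frameBracket (p : Pt n m) : Idx m → Idx m → Idx m → ℂ
  | .inl (.inl α), .inl (.inl β), .inl (.inl γ) => structFn A S γ α β p.1
  | .inr (.inl α), .inr (.inl β), .inr (.inl γ) => (starRingEnd ℂ) (structFn A S γ α β p.1)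
  | _, _, _ => 0

/-- The Lie bracket of the Lie algebroid `𝒯_ℂE`: it has the prescribed values on the natural
frame and satisfies the Leibniz rule. -/
def secBracket (X Y : Sec n m) : Sec n m := fun p c =>
  act A S X (fun q => Y q c) p - act A S Y (fun q => X q c) p
    + ∑ a, ∑ b, X p a * Y p b * frameBracket A S p a b c

/-- The covector `δ𝒱^α = 𝒱^α + N^α_β 𝒵^β` at `p`. -/
def coV (p : Pt n m) (α : Fin m) (y : Idx m → ℂ) : ℂ :=
  y (iV α) + ∑ β, nonlin A F S α β p * y (iZ β)

/-- The covector `δ𝒱^ᾱ`, conjugate to `δ𝒱^α`, at `p`. -/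
def coVbar (p : Pt n m) (α : Fin m) (y : Idx m → ℂ) : ℂ :=
  y (iVbar α) + ∑ β, (starRingEnd ℂ) (nonlin A F S α β p) * y (iZbar β)

/-- The Hermitian form
`Φ = i h_{αβ̄} (𝒵^α ∧ 𝒵^β̄ + δ𝒱^α ∧ δ𝒱^β̄)` at `p`, where `(a ∧ b)(x, y) = a(x) b(y) - a(y) b(x)`. -/
def hermForm (p : Pt n m) (x y : Idx m → ℂ) : ℂ :=
  I * ∑ α, ∑ β, metricTensor F S p α β *
    ((x (iZ α) * y (iZbar β) - y (iZ α) * x (iZbar β))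
      + (coV A F S p α x * coVbar A F S p β y - coV A F S p α y * coVbar A F S p β x))

/-- The `r`-th exterior power `θ ∧ ⋯ ∧ θ` of a `2`-form `θ`, as a form of degree `2r` in the
arguments `y (1,1), y (1,2), y (2,1), y (2,2), …, y (r,1), y (r,2)`. -/
def wedgePow {V : Type*} (θ : V → V → ℂ) (r : ℕ) (y : Fin r × Fin 2 → V) : ℂ :=
  (1 / 2 ^ r) * ∑ σ : Equiv.Perm (Fin r × Fin 2),
    ((Equiv.Perm.sign σ : ℤ) : ℂ) * ∏ i, θ (y (σ (i, 0))) (y (σ (i, 1)))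

/-- The volume form `d𝒱 = Φ^{2m} / (2m)!`, a form of degree `4m` on `𝒯_ℂE`, at `p`. -/
def volForm (p : Pt n m) (y : Fin (2 * m) × Fin 2 → Idx m → ℂ) : ℂ :=
  (1 / ((2 * m).factorial : ℂ)) * wedgePow (hermForm A F S p) (2 * m) y

/-- The Lie derivative of a form `η` on `𝒯_ℂE` along the section `Z`,
`(ℒ_Z η)(Y_1, …, Y_k) = Z(η(Y_1, …, Y_k)) - ∑_j η(Y_1, …, [Z, Y_j], …, Y_k)`. -/
def lieDeriv {κ : Type*} [Fintype κ] [DecidableEq κ] (Z : Sec n m)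
    (η : Pt n m → (κ → Idx m → ℂ) → ℂ) (Y : κ → Sec n m) (p : Pt n m) : ℂ :=
  act A S Z (fun q => η q (fun j => Y j q)) p
    - ∑ j, η p (Function.update (fun i => Y i p) j (secBracket A S Z (Y j) p))

/-- The function `d` is the divergence of the section `Z` of `𝒯_ℂE`:
`ℒ_Z d𝒱 = d · d𝒱` on the coordinate domain, as an identity of differential forms. -/
def IsDivergence (Z : Sec n m) (d : Pt n m → ℂ) : Prop :=
  ∀ Y : Fin (2 * m) × Fin 2 → Sec n m, (∀ j, ContDiffOn ℝ ∞ (Y j) S.domain) →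
    ∀ p ∈ S.domain,
      lieDeriv A S Z (volForm A F S) Y p = d p * volForm A F S p (fun j => Y j p)

end Local

end FinslerAlgebroid

end

/-! In the natural frame the volume form has a simple density. After a linear change of the frame
components, `Φ` becomes the standard symplectic form (`hermForm_eq_stdForm`). The matrix of this
change is block triangular, so the coefficients `N` drop out of its determinant, which is `(-1)^m
(det h)²`. A top exterior power is a multiple of the determinant, hence `d𝒱 = c (det h)² det` with a
constant `c ≠ 0` (`volForm_eq`).

The bracket is `[Z, Y] = Z(Y) - T Y`, with `Z(Y)` the componentwise derivative and `T = twist Z` a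
matrix independent of `Y`. By Jacobi's formula the terms in `Z(Y)` cancel in the Lie derivative,
leaving `div Z = tr T + 2 Z(det h) / det h` (`lieDeriv_volForm`). As `d𝒱` is nonzero on the natural
frame, this is the only divergence (`isDivergence_iff`).

It remains to express this in the Chern-Finsler connection. The logarithmic derivatives of `det h`
along `δ_α` and `∂̇_α` are `L^β_{βα}` and `C^β_{βα}`. The natural components of `Z^α 𝒳_α` are `Z^α`
and `-Z^β N^α_β`; since `∂̇_γ N^β_α = L^β_{γα}` (`du_nonlin`), the trace of `T` contributes `-Z^α
L^β_{βα}`, which cancels one of the two copies coming from `(det h)²`. The remaining copy is what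
`∇_{𝒳_α} Z^α - Z^α L_α` contains. In the vertical case both copies survive: by the symmetry of
`C^γ_{αβ}` in its lower indices, one belongs to `∇_{𝒱_α} V^α` and the other is `V^α C_α`. -/

noncomputable section

namespace FinslerAlgebroid

/-! ### Top exterior powers of a bilinear form -/

section ExteriorPower

variable {V : Type*} [AddCommGroup V] [Module ℂ V] {r : ℕ}

/-- The multilinear map `y ↦ ∏ i, B (y (i, 0)) (y (i, 1))`. -/
def pairProd (B : V →ₗ[ℂ] V →ₗ[ℂ] ℂ) (r : ℕ) :
    MultilinearMap ℂ (fun _ : Fin r × Fin 2 => V) ℂ where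
  toFun y := ∏ i, B (y (i, 0)) (y (i, 1))
  map_update_add' {inst} y j a b := by
    -- The field quantifies over all decidability instances; this one is replaced by the product
    -- instance, so that the updates below agree.
    obtain rfl : inst = instDecidableEqProd := Subsingleton.elim _ _
    obtain ⟨i, s⟩ := j
    simp only [← Finset.mul_prod_erase _ _ (Finset.mem_univ i)]
    have h : ∀ c : V, ∏ k ∈ Finset.univ.erase i, B (Function.update y (i, s) c (k, 0))
        (Function.update y (i, s) c (k, 1)) =
        ∏ k ∈ Finset.univ.erase i, B (y (k, 0)) (y (k, 1)) := fun c =>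
      Finset.prod_congr rfl fun k hk => by
        simp [Function.update_of_ne, Finset.ne_of_mem_erase hk]
    rw [h, h, h, ← add_mul]
    fin_cases s <;> simp
  map_update_smul' {inst} y j c a := by
    obtain rfl : inst = instDecidableEqProd := Subsingleton.elim _ _
    obtain ⟨i, s⟩ := j
    simp only [← Finset.mul_prod_erase _ _ (Finset.mem_univ i)]
    have h : ∀ c : V, ∏ k ∈ Finset.univ.erase i, B (Function.update y (i, s) c (k, 0))
        (Function.update y (i, s) c (k, 1)) =
        ∏ k ∈ Finset.univ.erase i, B (y (k, 0)) (y (k, 1)) := fun c =>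
      Finset.prod_congr rfl fun k hk => by
        simp [Function.update_of_ne, Finset.ne_of_mem_erase hk]
    rw [h, h, smul_eq_mul, ← mul_assoc]
    fin_cases s <;> simp

lemma wedgePow_eq_alternatization (B : V →ₗ[ℂ] V →ₗ[ℂ] ℂ) (y : Fin r × Fin 2 → V) :
    wedgePow (fun v w => B v w) r y =
      (1 / 2 ^ r) * MultilinearMap.alternatization (pairProd B r) y := by
  rw [wedgePow, MultilinearMap.alternatization_apply]
  congr 1
  refine Finset.sum_congr rfl fun σ _ => ?_
  rw [Units.smul_def, zsmul_eq_mul]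
  rfl

/-- The top exterior power of a bilinear form is a multiple of the determinant. -/
lemma wedgePow_eq_mul_det (B : V →ₗ[ℂ] V →ₗ[ℂ] ℂ) (b : Module.Basis (Fin r × Fin 2) ℂ V)
    (y : Fin r × Fin 2 → V) :
    wedgePow (fun v w => B v w) r y = wedgePow (fun v w => B v w) r b * b.det y := by
  rw [wedgePow_eq_alternatization, wedgePow_eq_alternatization,
    AlternatingMap.eq_smul_basis_det b (MultilinearMap.alternatization (pairProd B r))]
  simp [mul_assoc, b.det_self]

/-- If `σ` respects the pairs `{(i, 0), (i, 1)}`, its sign is the product of the signs with which it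
acts on the pairs. -/
lemma sign_eq_prod_of_fst_eq (σ : Equiv.Perm (Fin r × Fin 2))
    (h : ∀ i, (σ (i, 0)).1 = (σ (i, 1)).1) :
    ((Equiv.Perm.sign σ : ℤ) : ℂ) =
      ∏ i, ((((σ (i, 1)).2 : ℕ) : ℂ) - (((σ (i, 0)).2 : ℕ) : ℂ)) := by
  have h1 : ∀ i s, (σ (i, s)).1 = (σ (i, 0)).1 := fun i s => by
    fin_cases s
    · rfl
    · exact (h i).symm
  have hsurj : Function.Surjective fun i => (σ (i, 0)).1 := fun k => by
    obtain ⟨⟨i, s⟩, hi⟩ := σ.surjective (k, 0)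
    exact ⟨i, by simp [← h1 i s, hi]⟩
  let q : Equiv.Perm (Fin r) :=
    Equiv.ofBijective _ (Finite.surjective_iff_bijective.1 hsurj)
  have hbij : ∀ i, Function.Bijective fun s => (σ (i, s)).2 := fun i => by
    refine Finite.injective_iff_bijective.1 fun s t hst => ?_
    have := σ.injective (Prod.ext ((h1 i s).trans (h1 i t).symm) hst)
    simpa using this
  let τ : Fin r → Equiv.Perm (Fin 2) := fun i => Equiv.ofBijective _ (hbij i)
  -- `σ` acts first inside each pair by `τ i`, then permutes the pairs by `q`.
  have hσ : σ = (Equiv.prodCongrRight τ).trans (Equiv.prodCongrLeft fun _ => q) := by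
    ext ⟨i, s⟩ : 1
    exact Prod.ext (h1 i s) rfl
  have key : ∀ ρ : Equiv.Perm (Fin 2),
      ((Equiv.Perm.sign ρ : ℤ) : ℂ) = (((ρ 1 : Fin 2) : ℕ) : ℂ) - (((ρ 0 : Fin 2) : ℕ) : ℂ) := by
    have : ∀ ρ : Equiv.Perm (Fin 2),
        (Equiv.Perm.sign ρ : ℤ) = (((ρ 1 : Fin 2) : ℕ) : ℤ) - (((ρ 0 : Fin 2) : ℕ) : ℤ) := by
      decide
    intro ρ
    rw [this]
    push_cast
    rfl
  -- `q` acts on both members of each pair, so its sign enters squared and disappears.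
  have hs : Equiv.Perm.sign σ = ∏ i, Equiv.Perm.sign (τ i) := by
    conv_lhs => rw [hσ]
    rw [Equiv.Perm.sign_trans, Equiv.Perm.sign_prodCongrLeft]
    simp [Equiv.Perm.sign_prodCongrRight]
  rw [hs]
  push_cast
  exact Finset.prod_congr rfl fun i _ => key (τ i)

/-- The top exterior power of the standard symplectic form does not vanish on a symplectic
basis. -/
lemma wedgePow_symplectic_ne_zero {W : Type*} (θ : W → W → ℂ) (b : Fin r × Fin 2 → W)
    (h : ∀ i j s t, θ (b (i, s)) (b (j, t)) =
      if i = j then ((t : ℕ) : ℂ) - ((s : ℕ) : ℂ) else 0) :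
    wedgePow θ r b ≠ 0 := by
  classical
  have hterm : ∀ σ : Equiv.Perm (Fin r × Fin 2),
      ((Equiv.Perm.sign σ : ℤ) : ℂ) * ∏ i, θ (b (σ (i, 0))) (b (σ (i, 1))) =
        if ∀ i, (σ (i, 0)).1 = (σ (i, 1)).1 then 1 else 0 := by
    intro σ
    split_ifs with hσ
    · have : ∀ i, θ (b (σ (i, 0))) (b (σ (i, 1))) =
          (((σ (i, 1)).2 : ℕ) : ℂ) - (((σ (i, 0)).2 : ℕ) : ℂ) := fun i => by
        rw [← Prod.mk.eta (p := σ (i, 0)), ← Prod.mk.eta (p := σ (i, 1)), h, if_pos (hσ i)]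
      -- The product of the values of `θ` is again the sign of `σ`, so the term is a square of a
      -- sign.
      rw [Finset.prod_congr rfl fun i _ => this i, ← sign_eq_prod_of_fst_eq σ hσ,
        ← Int.cast_mul, ← Units.val_mul, Int.units_mul_self]
      simp
    · push Not at hσ
      obtain ⟨i, hi⟩ := hσ
      rw [Finset.prod_eq_zero (Finset.mem_univ i), mul_zero]
      rw [← Prod.mk.eta (p := σ (i, 0)), ← Prod.mk.eta (p := σ (i, 1)), h, if_neg hi]
  -- The sum counts the permutations that respect the pairs; the identity is one of them.
  rw [wedgePow, Finset.sum_congr rfl fun σ _ => hterm σ, Finset.sum_boole]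
  refine mul_ne_zero (by positivity) ?_
  rw [Nat.cast_ne_zero]
  exact Finset.card_ne_zero_of_mem (a := 1) (by simp)

end ExteriorPower

/-! ### The standard symplectic form and its volume -/

section StandardForm

variable {ι : Type*} [Fintype ι]

/-- The standard symplectic form on `ℂ^(ι ⊕ ι)`. -/
def stdForm (ι : Type*) [Fintype ι] : (ι ⊕ ι → ℂ) →ₗ[ℂ] (ι ⊕ ι → ℂ) →ₗ[ℂ] ℂ :=
  LinearMap.mk₂ ℂ (fun x y => ∑ k, (x (.inl k) * y (.inr k) - y (.inl k) * x (.inr k)))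
    (fun x x' y => by simp only [Pi.add_apply, ← Finset.sum_add_distrib]; congr! 1; ring)
    (fun c x y => by
      simp only [Pi.smul_apply, smul_eq_mul, Finset.mul_sum]; congr! 1; ring)
    (fun x y y' => by simp only [Pi.add_apply, ← Finset.sum_add_distrib]; congr! 1; ring)
    (fun c x y => by
      simp only [Pi.smul_apply, smul_eq_mul, Finset.mul_sum]; congr! 1; ring)

lemma stdForm_apply (x y : ι ⊕ ι → ℂ) :
    stdForm ι x y = ∑ k, (x (.inl k) * y (.inr k) - y (.inl k) * x (.inr k)) := rfl

/-- The bijection between pairs `(i, s)` and indices which sends `(i, 0)` and `(i, 1)` to the two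
conjugate indices numbered by `i`. -/
def pairIdx (m : ℕ) : Fin (2 * m) × Fin 2 ≃ Idx m :=
  ((Fintype.equivFinOfCardEq (α := Fin m ⊕ Fin m) (by simp [two_mul])).symm.prodCongr
    finTwoEquiv).trans ((Equiv.prodComm _ _).trans (Equiv.boolProdEquivSum _))

/-- The value of `θ^{2m}` on the basis of unit vectors, for the standard symplectic form `θ`. -/
def stdVol (m : ℕ) : ℂ :=
  wedgePow (fun v w => stdForm (Fin m ⊕ Fin m) v w) (2 * m)
    fun j => Pi.single (pairIdx m j) 1

lemma stdVol_ne_zero (m : ℕ) : stdVol m ≠ 0 := by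
  refine wedgePow_symplectic_ne_zero _ _ fun i j s t => ?_
  have h0 : ∀ i, pairIdx m (i, 0) =
    .inl ((Fintype.equivFinOfCardEq (α := Fin m ⊕ Fin m) (by simp [two_mul])).symm i) :=
      fun i => rfl
  have h1 : ∀ i, pairIdx m (i, 1) =
    .inr ((Fintype.equivFinOfCardEq (α := Fin m ⊕ Fin m) (by simp [two_mul])).symm i) :=
      fun i => rfl
  fin_cases s <;> fin_cases t <;>
    simp [h0, h1, stdForm_apply, Pi.single_apply, Finset.sum_ite_eq', eq_comm, apply_ite]

/-- The matrix with the columns `y j`. -/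
def colMatrix {m : ℕ} (y : Fin (2 * m) × Fin 2 → Idx m → ℂ) : Matrix (Idx m) (Idx m) ℂ :=
  Matrix.of fun a b => y ((pairIdx m).symm b) a

lemma wedgePow_stdForm (m : ℕ) (y : Fin (2 * m) × Fin 2 → Idx m → ℂ) :
    wedgePow (fun v w => stdForm (Fin m ⊕ Fin m) v w) (2 * m) y =
      stdVol m * (colMatrix y).det := by
  have hb : ∀ j, (Pi.basisFun ℂ (Idx m)).reindex (pairIdx m).symm j =
      Pi.single (pairIdx m j) 1 := fun j => by simp
  rw [wedgePow_eq_mul_det _ ((Pi.basisFun ℂ (Idx m)).reindex (pairIdx m).symm) y, stdVol]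
  congr 1
  · congr 1
    exact funext hb
  · rw [Module.Basis.det_apply, ← Matrix.det_reindex_self (pairIdx m)]
    congr 1
    ext a b
    simp [colMatrix, Module.Basis.toMatrix_apply]

end StandardForm

/-! ### Complex tangent vectors as derivations; Jacobi's formula -/

section Derivation

variable {W : Type*} [NormedAddCommGroup W] [NormedSpace ℝ W] {p : W}

/-- `D` is a complex tangent vector at `p`, acting on functions as a first order differential
operator. -/
def IsTangentAt (p : W) (D : (W → ℂ) → ℂ) : Prop :=
  ∃ l : (W →L[ℝ] ℂ) →ₗ[ℂ] ℂ, ∀ f, D f = l (fderiv ℝ f p)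

namespace IsTangentAt

variable {D D' : (W → ℂ) → ℂ}

lemma fderiv_apply (p v : W) : IsTangentAt p fun f => fderiv ℝ f p v :=
  ⟨{ toFun := fun l => l v, map_add' := fun _ _ => rfl, map_smul' := fun _ _ => rfl },
    fun _ => rfl⟩

lemma add_op (h : IsTangentAt p D) (h' : IsTangentAt p D') :
    IsTangentAt p fun f => D f + D' f := by
  obtain ⟨l, hl⟩ := h
  obtain ⟨l', hl'⟩ := h'
  exact ⟨l + l', fun f => by simp [hl, hl']⟩

lemma const_mul_op (h : IsTangentAt p D) (c : ℂ) : IsTangentAt p fun f => c * D f := by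
  obtain ⟨l, hl⟩ := h
  exact ⟨c • l, fun f => by simp [hl]⟩

lemma sub_op (h : IsTangentAt p D) (h' : IsTangentAt p D') :
    IsTangentAt p fun f => D f - D' f := by
  simpa [sub_eq_add_neg] using h.add_op (h'.const_mul_op (-1))

lemma sum_op {ι : Type*} {s : Finset ι} {D : ι → (W → ℂ) → ℂ}
    (h : ∀ i, IsTangentAt p (D i)) : IsTangentAt p fun f => ∑ i ∈ s, D i f := by
  choose l hl using h
  exact ⟨∑ i ∈ s, l i, fun f => by simp [hl]⟩

lemma congr (h : IsTangentAt p D) {f g : W → ℂ} (hfg : f =ᶠ[nhds p] g) : D f = D g := by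
  obtain ⟨l, hl⟩ := h
  rw [hl, hl, hfg.fderiv_eq]

lemma add (h : IsTangentAt p D) {f g : W → ℂ} (hf : DifferentiableAt ℝ f p)
    (hg : DifferentiableAt ℝ g p) : D (fun q => f q + g q) = D f + D g := by
  obtain ⟨l, hl⟩ := h
  rw [hl, hl, hl, fderiv_fun_add hf hg, map_add]

lemma mul (h : IsTangentAt p D) {f g : W → ℂ} (hf : DifferentiableAt ℝ f p)
    (hg : DifferentiableAt ℝ g p) : D (fun q => f q * g q) = f p * D g + g p * D f := by
  obtain ⟨l, hl⟩ := h
  rw [hl, hl, hl, fderiv_fun_mul hf hg, map_add, map_smul, map_smul, smul_eq_mul, smul_eq_mul]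

lemma const (h : IsTangentAt p D) (c : ℂ) : D (fun _ => c) = 0 := by
  obtain ⟨l, hl⟩ := h
  rw [hl, fderiv_fun_const]
  exact map_zero l

lemma const_mul (h : IsTangentAt p D) (c : ℂ) {f : W → ℂ} (hf : DifferentiableAt ℝ f p) :
    D (fun q => c * f q) = c * D f := by
  rw [h.mul (differentiableAt_const c) hf, h.const]
  simp

lemma neg (h : IsTangentAt p D) (f : W → ℂ) : D (fun q => -f q) = -D f := by
  obtain ⟨l, hl⟩ := h
  rw [hl, hl, fderiv_fun_neg, map_neg]

lemma sum (h : IsTangentAt p D) {ι : Type*} {s : Finset ι} {f : ι → W → ℂ}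
    (hf : ∀ i ∈ s, DifferentiableAt ℝ (f i) p) :
    D (fun q => ∑ i ∈ s, f i q) = ∑ i ∈ s, D (f i) := by
  obtain ⟨l, hl⟩ := h
  simp only [hl, fderiv_fun_sum hf, map_sum]

lemma prod (h : IsTangentAt p D) {ι : Type*} [DecidableEq ι] {s : Finset ι} {f : ι → W → ℂ}
    (hf : ∀ i ∈ s, DifferentiableAt ℝ (f i) p) :
    D (fun q => ∏ i ∈ s, f i q) = ∑ i ∈ s, (∏ j ∈ s.erase i, f j p) * D (f i) := by
  obtain ⟨l, hl⟩ := h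
  simp only [hl, (HasFDerivAt.finsetProd fun i hi => (hf i hi).hasFDerivAt).fderiv, map_sum,
    map_smul, smul_eq_mul]

/-- Jacobi's formula. -/
lemma det (h : IsTangentAt p D) {ι : Type*} [Fintype ι] [DecidableEq ι]
    {M : W → Matrix ι ι ℂ} (hM : ∀ i j, DifferentiableAt ℝ (fun q => M q i j) p) :
    D (fun q => (M q).det) =
      ((M p).adjugate * Matrix.of fun i j => D fun q => M q i j).trace := by
  -- The Leibniz rule differentiates one column at a time; Cramer's rule then turns each determinant
  -- into a diagonal entry of the adjugate product.
  have h1 : D (fun q => (M q).det) =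
      ∑ j, ((M p).updateCol j fun i => D fun q => M q i j).det := by
    have hp : ∀ σ : Equiv.Perm ι, DifferentiableAt ℝ (fun q => ∏ i, M q (σ i) i) p := fun σ =>
      (HasFDerivAt.finsetProd fun i _ => (hM (σ i) i).hasFDerivAt).differentiableAt
    simp only [Matrix.det_apply']
    rw [h.sum fun σ _ => (hp σ).const_mul _, Finset.sum_comm]
    refine Finset.sum_congr rfl fun σ _ => ?_
    rw [h.const_mul _ (hp σ), h.prod fun i _ => hM (σ i) i, Finset.mul_sum]
    refine Finset.sum_congr rfl fun j _ => ?_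
    rw [← Finset.mul_prod_erase _ _ (Finset.mem_univ j), Matrix.updateCol_self, mul_comm (D _)]
    congr 2
    exact Finset.prod_congr rfl fun k hk => by
      rw [Matrix.updateCol_ne (Finset.ne_of_mem_erase hk)]
  rw [h1, Matrix.trace]
  refine Finset.sum_congr rfl fun j _ => ?_
  rw [← Matrix.cramer_apply, Matrix.cramer_eq_adjugate_mulVec]
  rfl

end IsTangentAt

lemma differentiableAt_det {ι : Type*} [Fintype ι] [DecidableEq ι] {M : W → Matrix ι ι ℂ}
    (hM : ∀ i j, DifferentiableAt ℝ (fun q => M q i j) p) :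
    DifferentiableAt ℝ (fun q => (M q).det) p := by
  simp only [Matrix.det_apply']
  exact DifferentiableAt.fun_sum fun σ _ =>
    ((HasFDerivAt.finsetProd fun i _ => (hM (σ i) i).hasFDerivAt).differentiableAt).const_mul _

lemma differentiableAt_inv_apply {ι : Type*} [Fintype ι] [DecidableEq ι] {M : W → Matrix ι ι ℂ}
    (hM : ∀ i j, DifferentiableAt ℝ (fun q => M q i j) p) (hdet : (M p).det ≠ 0) (i j : ι) :
    DifferentiableAt ℝ (fun q => (M q)⁻¹ i j) p := by
  simp only [Matrix.inv_def, Matrix.smul_apply, smul_eq_mul, Ring.inverse_eq_inv',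
    Matrix.adjugate_apply]
  refine ((differentiableAt_det hM).inv hdet).mul (differentiableAt_det fun a b => ?_)
  by_cases hab : a = j
  · simp [hab]
  · simpa [Matrix.updateRow_ne hab] using hM a b

end Derivation

/-! ### Wirtinger derivatives -/

section Wirtinger

variable {n m : ℕ} {p : Pt n m}

lemma isTangentAt_dHol (p v : Pt n m) : IsTangentAt p fun f => dHol f p v := by
  have := ((IsTangentAt.fderiv_apply p v).sub_op
    ((IsTangentAt.fderiv_apply p (I • v)).const_mul_op I)).const_mul_op (1 / 2)
  convert this using 2 with f
  rw [dHol]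
  ring

lemma isTangentAt_dAnti (p v : Pt n m) : IsTangentAt p fun f => dAnti f p v := by
  have := ((IsTangentAt.fderiv_apply p v).add_op
    ((IsTangentAt.fderiv_apply p (I • v)).const_mul_op I)).const_mul_op (1 / 2)
  convert this using 2 with f
  rw [dAnti]
  ring

lemma isTangentAt_du (p : Pt n m) (α : Fin m) : IsTangentAt p fun f => du α f p :=
  isTangentAt_dHol p _

lemma contDiffOn_fderiv_const {U : Set (Pt n m)} (hU : IsOpen U) {f : Pt n m → ℂ}
    (hf : ContDiffOn ℝ ∞ f U) (v : Pt n m) : ContDiffOn ℝ ∞ (fun q => fderiv ℝ f q v) U :=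
  (hf.fderiv_of_isOpen hU (by simp)).clm_apply contDiffOn_const

lemma contDiffOn_dHol {U : Set (Pt n m)} (hU : IsOpen U) {f : Pt n m → ℂ}
    (hf : ContDiffOn ℝ ∞ f U) (v : Pt n m) : ContDiffOn ℝ ∞ (fun q => dHol f q v) U :=
  ((contDiffOn_fderiv_const hU hf v).sub
    (contDiffOn_const.mul (contDiffOn_fderiv_const hU hf _))).div_const 2

lemma contDiffOn_dAnti {U : Set (Pt n m)} (hU : IsOpen U) {f : Pt n m → ℂ}
    (hf : ContDiffOn ℝ ∞ f U) (v : Pt n m) : ContDiffOn ℝ ∞ (fun q => dAnti f q v) U :=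
  ((contDiffOn_fderiv_const hU hf v).add
    (contDiffOn_const.mul (contDiffOn_fderiv_const hU hf _))).div_const 2

lemma fderiv_dHol {U : Set (Pt n m)} (hU : IsOpen U) {f : Pt n m → ℂ}
    (hf : ContDiffOn ℝ ∞ f U) (hp : p ∈ U) (v w : Pt n m) :
    fderiv ℝ (fun q => dHol f q v) p w =
      (fderiv ℝ (fderiv ℝ f) p w v - I * fderiv ℝ (fderiv ℝ f) p w (I • v)) / 2 := by
  have hd : DifferentiableAt ℝ (fderiv ℝ f) p :=
    ((hf.fderiv_of_isOpen (m := ∞) hU (by simp)).contDiffAt (hU.mem_nhds hp)).differentiableAt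
      (by simp)
  have hv : ∀ v, HasFDerivAt (fun q => fderiv ℝ f q v) ((fderiv ℝ (fderiv ℝ f) p).flip v) p :=
    fun v => by simpa using hd.hasFDerivAt.clm_apply (hasFDerivAt_const v p)
  have : HasFDerivAt (fun q => dHol f q v) _ p :=
    ((hv v).sub ((hv (I • v)).const_mul I)).mul_const (2⁻¹ : ℂ)
  rw [this.fderiv]
  simp
  ring

/-- Two derivatives of type `(1,0)` in constant directions commute. -/
lemma dHol_comm {U : Set (Pt n m)} (hU : IsOpen U) {f : Pt n m → ℂ}
    (hf : ContDiffOn ℝ ∞ f U) (hp : p ∈ U) (v w : Pt n m) :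
    dHol (fun q => dHol f q v) p w = dHol (fun q => dHol f q w) p v := by
  -- The symmetry of the real second derivative suffices, the directions `v`, `w` being constant.
  have hs : ∀ v w, fderiv ℝ (fderiv ℝ f) p v w = fderiv ℝ (fderiv ℝ f) p w v := fun v w =>
    ((hf.contDiffAt (hU.mem_nhds hp)).isSymmSndFDerivAt
      (by simpa using WithTop.coe_le_coe.2 (le_top : (2 : ℕ∞) ≤ ⊤))).eq v w
  rw [dHol, dHol, fderiv_dHol hU hf hp, fderiv_dHol hU hf hp, fderiv_dHol hU hf hp,
    fderiv_dHol hU hf hp, hs w v, hs w (I • v), hs (I • w) v, hs (I • w) (I • v)]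
  ring

/-- The functions of `z` are constant along the fibres. -/
lemma du_comp_fst (α : Fin m) {g : (Fin n → ℂ) → ℂ} (hg : DifferentiableAt ℝ g p.1) :
    du α (fun q => g q.1) p = 0 := by
  have : HasFDerivAt (fun q : Pt n m => g q.1) _ p :=
    hg.hasFDerivAt.comp p hasFDerivAt_fst
  simp [du, dHol, this.fderiv]

end Wirtinger

/-! ### The volume density and the divergence in the natural frame -/

section Divergence

variable {n m : ℕ}
  {M : Type*} [TopologicalSpace M] [ChartedSpace (Fin n → ℂ) M]
  [IsManifold 𝓘(ℂ, Fin n → ℂ) ω M]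
  {E : M → Type*} [∀ x, AddCommGroup (E x)] [∀ x, Module ℂ (E x)] [∀ x, TopologicalSpace (E x)]
  [TopologicalSpace (TotalSpace (Fin m → ℂ) E)] [FiberBundle (Fin m → ℂ) E]
  (A : HolLieAlgebroid n m E) (F : TotalSpace (Fin m → ℂ) E → ℝ) (S : LocalSystem n m E)

set_option linter.unusedSectionVars false in
lemma LocalSystem.isOpen_domain : IsOpen S.domain :=
  (S.chart.open_target.preimage continuous_fst).inter
    (isOpen_compl_singleton.preimage continuous_snd)

lemma isTangentAt_dAlg (α : Fin m) (p : Pt n m) : IsTangentAt p fun f => dAlg A S α f p :=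
  IsTangentAt.sum_op fun _ => (isTangentAt_dHol p _).const_mul_op _

lemma isTangentAt_delta (α : Fin m) (p : Pt n m) : IsTangentAt p fun f => delta A F S α f p :=
  (isTangentAt_dAlg A S α p).sub_op
    (IsTangentAt.sum_op fun β => (isTangentAt_du p β).const_mul_op _)

lemma isTangentAt_act (Y : Sec n m) (p : Pt n m) : IsTangentAt p fun f => act A S Y f p :=
  IsTangentAt.sum_op fun α =>
    ((((isTangentAt_dAlg A S α p).const_mul_op _).add_op
      ((isTangentAt_du p α).const_mul_op _)).add_op
        (IsTangentAt.const_mul_op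
          (IsTangentAt.sum_op fun _ => (isTangentAt_dAnti p _).const_mul_op _) _)).add_op
            ((isTangentAt_dAnti p _).const_mul_op _)

/-- The derivative along the section of the natural frame with index `c`. -/
def dIdx (p : Pt n m) (f : Pt n m → ℂ) : Idx m → ℂ
  | .inl (.inl α) => dAlg A S α f p
  | .inl (.inr α) => du α f p
  | .inr (.inl α) => dAlgBar A S α f p
  | .inr (.inr α) => duBar α f p

lemma act_eq_sum_dIdx (Y : Sec n m) (f : Pt n m → ℂ) (p : Pt n m) :
    act A S Y f p = ∑ c, Y p c * dIdx A S p f c := by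
  simp only [act, Fintype.sum_sum_type, dIdx, Finset.sum_add_distrib]
  ring

/-- The matrix of the linear map `Y ↦ Y(Z) - [Z, Y]_0`, where `Y(Z)` is the componentwise derivative
and `[·, ·]_0` is the bilinear extension of the bracket of the natural frame. -/
def twist (Z : Sec n m) (p : Pt n m) : Matrix (Idx m) (Idx m) ℂ :=
  Matrix.of fun c b => dIdx A S p (fun q => Z q c) b - ∑ a, Z p a * frameBracket A S p a b c

/-- This separates the part of the bracket that differentiates `Y` from the part that is linear in
the value of `Y` at `p`. Only the second part contributes to the divergence, through its trace. -/
lemma secBracket_eq (Z Y : Sec n m) (p : Pt n m) (c : Idx m) :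
    secBracket A S Z Y p c =
      act A S Z (fun q => Y q c) p - ∑ b, twist A S Z p c b * Y p b := by
  simp only [secBracket, act_eq_sum_dIdx A S Y, twist, Matrix.of_apply, sub_mul,
    Finset.sum_sub_distrib, Finset.sum_mul]
  rw [Finset.sum_comm (f := fun a b => Z p a * Y p b * frameBracket A S p a b c), sub_sub_eq_add_sub,
    sub_add_eq_add_sub]
  simp only [mul_comm, mul_left_comm]

/-- The linear map which takes `Φ` to the standard symplectic form. -/
def hermMap (p : Pt n m) : Matrix (Idx m) (Idx m) ℂ :=
  Matrix.fromBlocks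
    (Matrix.fromBlocks (I • (metricTensor F S p).transpose) 0
      ((I • (metricTensor F S p).transpose) * Matrix.of fun α β => nonlin A F S α β p)
      (I • (metricTensor F S p).transpose))
    0 0
    (Matrix.fromBlocks 1 0 (Matrix.of fun α β => (starRingEnd ℂ) (nonlin A F S α β p)) 1)

/-- The connection coefficients occupy only off-diagonal blocks of triangular matrices. The two
diagonal blocks `I • hᵀ` give the factor `I^{2m} = (-1)^m`. -/
lemma det_hermMap (p : Pt n m) :
    (hermMap A F S p).det = (-1) ^ m * (metricDet F S p) ^ 2 := by
  rw [hermMap, Matrix.det_fromBlocks_zero₂₁, Matrix.det_fromBlocks_zero₁₂,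
    Matrix.det_fromBlocks_zero₁₂, Matrix.det_smul, Matrix.det_transpose, metricDet]
  simp only [Fintype.card_fin, Matrix.det_one, mul_one]
  rw [show (-1 : ℂ) = I * I by simp, mul_pow]
  ring

/-- The factor `i h` is absorbed into the `(1,0)` coframe, while the `(0,1)` coframe is kept; each
barred covector is then paired with exactly one unbarred covector. -/
lemma hermForm_eq_stdForm (p : Pt n m) (x y : Idx m → ℂ) :
    hermForm A F S p x y =
      stdForm (Fin m ⊕ Fin m) (Matrix.mulVec (hermMap A F S p) x)
        (Matrix.mulVec (hermMap A F S p) y) := by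
  have hZ : ∀ x β, Matrix.mulVec (hermMap A F S p) x (iZ β) =
      ∑ α, I * metricTensor F S p α β * x (iZ α) := fun x β => by
    simp [hermMap, Matrix.mulVec, dotProduct, Fintype.sum_sum_type]
  have hZb : ∀ x β, Matrix.mulVec (hermMap A F S p) x (iZbar β) = x (iZbar β) := fun x β => by
    simp [hermMap, Matrix.mulVec, dotProduct, Fintype.sum_sum_type, Matrix.one_apply]
  have hVb : ∀ x β, Matrix.mulVec (hermMap A F S p) x (iVbar β) = coVbar A F S p β x :=
    fun x β => by
      simp [hermMap, Matrix.mulVec, dotProduct, Fintype.sum_sum_type, Matrix.one_apply, coVbar,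
        add_comm]
  have hV : ∀ x β, Matrix.mulVec (hermMap A F S p) x (iV β) =
      ∑ α, I * metricTensor F S p α β * coV A F S p α x := fun x β => by
    simp only [hermMap, Matrix.mulVec, dotProduct, Fintype.sum_sum_type,
      Matrix.fromBlocks_apply₁₁, Matrix.fromBlocks_apply₁₂, Matrix.fromBlocks_apply₂₁,
      Matrix.fromBlocks_apply₂₂, Matrix.mul_apply, Matrix.smul_apply, Matrix.transpose_apply,
      Matrix.of_apply, Matrix.zero_apply, coV, mul_add, Finset.sum_add_distrib, Finset.sum_mul,
      Finset.mul_sum, smul_eq_mul, zero_mul, Finset.sum_const_zero, add_zero]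
    rw [add_comm, Finset.sum_comm]
    simp only [mul_assoc]
  rw [stdForm_apply, Fintype.sum_sum_type]
  simp only [hZ, hZb, hV, hVb, hermForm]
  rw [Finset.sum_comm, Finset.mul_sum, ← Finset.sum_add_distrib]
  refine Finset.sum_congr rfl fun β _ => ?_
  simp only [Finset.sum_mul, Finset.mul_sum, ← Finset.sum_sub_distrib, ← Finset.sum_add_distrib]
  exact Finset.sum_congr rfl fun α _ => by ring

/-- The constant `c` in `d𝒱 = c (det h)² dx`. -/
def volConst (m : ℕ) : ℂ := (1 / ((2 * m).factorial : ℂ)) * stdVol m * (-1) ^ m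

lemma volConst_ne_zero (m : ℕ) : volConst m ≠ 0 :=
  mul_ne_zero (mul_ne_zero (by positivity) (stdVol_ne_zero m)) (by simp)

/-- The volume form is a multiple of `(det h)²` times the determinant. -/
lemma volForm_eq (p : Pt n m) (y : Fin (2 * m) × Fin 2 → Idx m → ℂ) :
    volForm A F S p y = volConst m * metricDet F S p ^ 2 * (colMatrix y).det := by
  have h1 : wedgePow (hermForm A F S p) (2 * m) y =
      wedgePow (fun v w => stdForm (Fin m ⊕ Fin m) v w) (2 * m)
        fun j => Matrix.mulVec (hermMap A F S p) (y j) := by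
    simp only [wedgePow, hermForm_eq_stdForm]
  have h2 : colMatrix (fun j => Matrix.mulVec (hermMap A F S p) (y j)) =
      hermMap A F S p * colMatrix y := rfl
  rw [volForm, h1, wedgePow_stdForm, h2, Matrix.det_mul, det_hermMap, volConst]
  ring

lemma colMatrix_update (y : Fin (2 * m) × Fin 2 → Idx m → ℂ) (j : Fin (2 * m) × Fin 2)
    (v : Idx m → ℂ) :
    colMatrix (Function.update y j v) = (colMatrix y).updateCol (pairIdx m j) v := by
  ext a b
  by_cases hb : b = pairIdx m j
  · simp [colMatrix, hb]
  · rw [Matrix.updateCol_ne hb, colMatrix, Matrix.of_apply, Function.update_of_ne, colMatrix,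
      Matrix.of_apply]
    rwa [Ne, Equiv.symm_apply_eq]

/-- The divergence of a section of `𝒯_ℂE` with respect to `(det h)² dx`. -/
def divFn (Z : Sec n m) (p : Pt n m) : ℂ :=
  (twist A S Z p).trace + 2 * act A S Z (metricDet F S) p / metricDet F S p

/-- With `B` the matrix of the arguments and `D` its derivative along `Z`, Jacobi's formula produces
`tr (adj B · D)`. The bracket terms subtract `tr (adj B · (D - T B))`, so `D` cancels and `tr (adj B
· T B) = det B · tr T` remains. -/
lemma lieDeriv_volForm {p : Pt n m} (hdet : metricDet F S p ≠ 0)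
    (hd : DifferentiableAt ℝ (metricDet F S) p) (Z : Sec n m)
    (Y : Fin (2 * m) × Fin 2 → Sec n m) (hY : ∀ j, DifferentiableAt ℝ (Y j) p) :
    lieDeriv A S Z (volForm A F S) Y p =
      divFn A F S Z p * volForm A F S p (fun j => Y j p) := by
  have hZ := isTangentAt_act A S Z p
  have hd2 : DifferentiableAt ℝ (fun q => metricDet F S q ^ 2) p := hd.pow 2
  have hY' : ∀ a b, DifferentiableAt ℝ (fun q => colMatrix (fun j => Y j q) a b) p :=
    fun a b => differentiableAt_pi.1 (hY ((pairIdx m).symm b)) a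
  set B := colMatrix (fun j => Y j p) with hB
  set D : Matrix (Idx m) (Idx m) ℂ :=
    Matrix.of fun a b => act A S Z (fun q => colMatrix (fun j => Y j q) a b) p with hD
  have h1 : act A S Z (fun q => volForm A F S q fun j => Y j q) p =
      volConst m * (metricDet F S p ^ 2 * (B.adjugate * D).trace +
        B.det * (2 * metricDet F S p * act A S Z (metricDet F S) p)) := by
    simp only [volForm_eq, mul_assoc]
    rw [hZ.const_mul (volConst m) (hd2.fun_mul (differentiableAt_det hY')),
      hZ.mul hd2 (differentiableAt_det hY'), hZ.det hY']
    simp only [pow_two]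
    rw [hZ.mul hd hd]
    ring
  -- Replacing the `j`-th column of `B` by `[Z, Y_j]` gives, by Cramer's rule, a diagonal entry of
  -- an adjugate product; the sum over `j` is a trace.
  have h2 : ∑ j, volForm A F S p
      (Function.update (fun i => Y i p) j (secBracket A S Z (Y j) p)) =
        volConst m * metricDet F S p ^ 2 * (B.adjugate * (D - twist A S Z p * B)).trace := by
    simp only [volForm_eq, colMatrix_update, ← Finset.mul_sum]
    congr 1
    rw [Matrix.trace, ← (pairIdx m).sum_comp]
    refine Finset.sum_congr rfl fun j _ => ?_
    rw [← hB, ← Matrix.cramer_apply, Matrix.cramer_eq_adjugate_mulVec]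
    simp only [Matrix.mulVec, dotProduct, Matrix.diag, Matrix.mul_apply (M := B.adjugate)]
    refine Finset.sum_congr rfl fun c _ => ?_
    rw [secBracket_eq, Matrix.sub_apply, Matrix.mul_apply]
    simp [hD, hB, colMatrix]
  have h3 : (B.adjugate * (twist A S Z p * B)).trace = B.det * (twist A S Z p).trace := by
    rw [Matrix.trace_mul_comm, Matrix.mul_assoc, Matrix.mul_adjugate]
    simp
  rw [lieDeriv, h1, h2, Matrix.mul_sub, Matrix.trace_sub, h3, volForm_eq, divFn, ← hB]
  field_simp
  ring

/-- Existence and uniqueness of the divergence. -/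
lemma isDivergence_iff (hdet : ∀ p ∈ S.domain, metricDet F S p ≠ 0)
    (hd : ∀ p ∈ S.domain, DifferentiableAt ℝ (metricDet F S) p) (Z : Sec n m)
    (d : Pt n m → ℂ) :
    IsDivergence A F S Z d ↔ ∀ p ∈ S.domain, d p = divFn A F S Z p := by
  constructor
  · intro h p hp
    -- For uniqueness it is enough to test on the natural frame, where the matrix of arguments is
    -- the identity and the volume form is nonzero.
    have h1 := h (fun j _ => Pi.single (pairIdx m j) 1) (fun _ => contDiffOn_const) p hp
    rw [lieDeriv_volForm A F S (hdet p hp) (hd p hp) Z _ fun _ => differentiableAt_const _] at h1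
    refine (mul_right_cancel₀ ?_ h1).symm
    have h2 : colMatrix (fun j => Pi.single (pairIdx m j) (1 : ℂ)) = 1 := by
      ext a b
      simp [colMatrix, Matrix.one_apply, Pi.single_apply]
    rw [volForm_eq, h2, Matrix.det_one, mul_one]
    exact mul_ne_zero (volConst_ne_zero m) (pow_ne_zero 2 (hdet p hp))
  · intro h Y hY p hp
    rw [h p hp]
    exact lieDeriv_volForm A F S (hdet p hp) (hd p hp) Z Y fun j =>
      ((hY j).contDiffAt (S.isOpen_domain.mem_nhds hp)).differentiableAt (by simp)

lemma isTangentAt_dIdx (p : Pt n m) (c : Idx m) : IsTangentAt p fun f => dIdx A S p f c := by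
  rcases c with (α | α) | (α | α)
  · exact isTangentAt_dAlg A S α p
  · exact isTangentAt_du p α
  · exact (IsTangentAt.sum_op fun _ => (isTangentAt_dAnti p _).const_mul_op _ :
      IsTangentAt p fun f => dAlgBar A S α f p)
  · exact isTangentAt_dAnti p _

lemma divFn_congr {p : Pt n m} {Z Z' : Sec n m} (h : Z =ᶠ[nhds p] Z') :
    divFn A F S Z p = divFn A F S Z' p := by
  have h1 : ∀ b c, dIdx A S p (fun q => Z q c) b = dIdx A S p (fun q => Z' q c) b := fun b c =>
    (isTangentAt_dIdx A S p b).congr (h.mono fun q hq => by simp [hq])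
  simp only [divFn, twist, act_eq_sum_dIdx, h1, h.eq_of_nhds]

lemma divFn_add {p : Pt n m} {Z Z' : Sec n m} (hZ : DifferentiableAt ℝ Z p)
    (hZ' : DifferentiableAt ℝ Z' p) :
    divFn A F S (fun q => Z q + Z' q) p = divFn A F S Z p + divFn A F S Z' p := by
  have h1 : ∀ b c, dIdx A S p (fun q => (Z q + Z' q) c) b =
      dIdx A S p (fun q => Z q c) b + dIdx A S p (fun q => Z' q c) b := fun b c =>
    (isTangentAt_dIdx A S p b).add (differentiableAt_pi.1 hZ c) (differentiableAt_pi.1 hZ' c)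
  have h2 : twist A S (fun q => Z q + Z' q) p = twist A S Z p + twist A S Z' p := by
    ext c b
    simp only [twist, Matrix.of_apply, Matrix.add_apply, h1]
    simp only [Pi.add_apply, add_mul, Finset.sum_add_distrib]
    ring
  simp only [divFn, h2, Matrix.trace_add, act_eq_sum_dIdx, Pi.add_apply, add_mul,
    Finset.sum_add_distrib]
  ring

/-- The divergence of a section of `𝒯'E`, in the natural frame. -/
lemma divFn_of_type_one_zero {p : Pt n m} {Z : Sec n m} (hZ : ∀ q c, Z q (.inr c) = 0) :
    divFn A F S Z p =
      ∑ α, (dAlg A S α (fun q => Z q (iZ α)) p + du α (fun q => Z q (iV α)) p)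
        - ∑ α, Z p (iZ α) * traceStruct A S α p
        + 2 * (∑ α, (Z p (iZ α) * dAlg A S α (metricDet F S) p
          + Z p (iV α) * du α (metricDet F S) p)) / metricDet F S p := by
  have h0 : ∀ a, dIdx A S p (fun _ => 0) a = 0 := fun a => (isTangentAt_dIdx A S p a).const 0
  have h1 : ∀ α, dAlgBar A S α (fun _ => 0) p = 0 := fun α => h0 (.inr (.inl α))
  have h2 : ∀ α, duBar α (fun _ => 0) p = 0 := fun α => h0 (.inr (.inr α))
  -- The conjugate brackets are weighted by the `(0,1)` components of `Z`, which vanish; only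
  -- `𝒞^β_{αβ}` survives in the trace.
  have hT : (twist A S Z p).trace =
      ∑ α, (dAlg A S α (fun q => Z q (iZ α)) p + du α (fun q => Z q (iV α)) p)
        - ∑ α, Z p (iZ α) * traceStruct A S α p := by
    simp only [Matrix.trace, Matrix.diag, twist, Matrix.of_apply, Finset.sum_sub_distrib,
      Fintype.sum_sum_type, hZ, frameBracket, dIdx, traceStruct, Finset.mul_sum]
    rw [Finset.sum_comm (f := fun α β => Z p (iZ α) * structFn A S β α β p.1)]
    simp [Finset.sum_add_distrib, h1, h2]
  rw [divFn, hT]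
  congr 3
  simp [act, hZ]

end Divergence

/-! ### The Chern-Finsler connection -/

section ChernFinsler

variable {n m : ℕ}
  {M : Type*} [TopologicalSpace M] [ChartedSpace (Fin n → ℂ) M]
  [IsManifold 𝓘(ℂ, Fin n → ℂ) ω M]
  {E : M → Type*} [∀ x, AddCommGroup (E x)] [∀ x, Module ℂ (E x)] [∀ x, TopologicalSpace (E x)]
  [TopologicalSpace (TotalSpace (Fin m → ℂ) E)] [FiberBundle (Fin m → ℂ) E]
  (A : HolLieAlgebroid n m E) {F : TotalSpace (Fin m → ℂ) E → ℝ} (S : LocalSystem n m E)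

/-- The anchor coefficients are holomorphic. -/
lemma contDiffOn_anchorCoeff (k : Fin n) (α : Fin m) :
    ContDiffOn ℂ 1 (anchorCoeff A S k α) S.chart.target := by
  have h1 : ContMDiffOn 𝓘(ℂ, Fin n → ℂ) (𝓘(ℂ, Fin n → ℂ).tangent) 1
      (fun x => (⟨x, A.anchor x (S.frame α x)⟩ : TangentBundle 𝓘(ℂ, Fin n → ℂ) M))
      S.chart.source :=
    (A.anchor_hol _ _ S.chart.open_source (S.isFrame.contMDiffOn α)).of_le le_top
  -- The coefficients are the fibre part of the tangent map of the chart applied to `ρ(e_α)`. The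
  -- chart is smooth only on its source, hence the tangent map within that set, identified with the
  -- full derivative in `h6`.
  have h2 : ContMDiffOn (𝓘(ℂ, Fin n → ℂ).tangent) (𝓘(ℂ, Fin n → ℂ).tangent) 1
      (tangentMapWithin 𝓘(ℂ, Fin n → ℂ) 𝓘(ℂ, Fin n → ℂ) S.chart S.chart.source)
      (TotalSpace.proj ⁻¹' S.chart.source) :=
    (contMDiffOn_of_mem_maximalAtlas S.chart_mem).contMDiffOn_tangentMapWithin le_top
      S.chart.open_source.uniqueMDiffOn
  have h3 := (contMDiff_snd_tangentBundle_modelSpace (n := 1) (Fin n → ℂ)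
    𝓘(ℂ, Fin n → ℂ)).comp_contMDiffOn (h2.comp h1 fun x hx => hx)
  have h4 : ContMDiffOn 𝓘(ℂ, Fin n → ℂ) 𝓘(ℂ, Fin n → ℂ) 1 S.chart.symm S.chart.target :=
    (contMDiffOn_symm_of_mem_maximalAtlas S.chart_mem).of_le le_top
  have h5 := (h3.comp h4 fun z hz => S.chart.map_target hz).contDiffOn
  refine (contDiffOn_pi.1 h5 k).congr fun z hz => ?_
  have h6 : mfderivWithin 𝓘(ℂ, Fin n → ℂ) 𝓘(ℂ, Fin n → ℂ) S.chart S.chart.source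
      (S.chart.symm z) = mfderiv 𝓘(ℂ, Fin n → ℂ) 𝓘(ℂ, Fin n → ℂ) S.chart (S.chart.symm z) :=
    mfderivWithin_of_mem_nhds (S.chart.open_source.mem_nhds (S.chart.map_target hz))
  change _ = (mfderivWithin 𝓘(ℂ, Fin n → ℂ) 𝓘(ℂ, Fin n → ℂ) S.chart S.chart.source
    (S.chart.symm z) (A.anchor (S.chart.symm z) (S.frame α (S.chart.symm z))) : Fin n → ℂ) k
  rw [h6]
  rfl

lemma differentiableAt_anchorCoeff (k : Fin n) (α : Fin m) {z : Fin n → ℂ}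
    (hz : z ∈ S.chart.target) : DifferentiableAt ℝ (anchorCoeff A S k α) z :=
  (((contDiffOn_anchorCoeff A S k α).contDiffAt
    (S.chart.open_target.mem_nhds hz)).differentiableAt one_ne_zero).restrictScalars ℝ

variable {S} {p : Pt n m}

lemma differentiableAt_of_contDiffOn_domain {G : Type*} [NormedAddCommGroup G]
    [NormedSpace ℝ G] {f : Pt n m → G} (hf : ContDiffOn ℝ ∞ f S.domain)
    (hp : p ∈ S.domain) : DifferentiableAt ℝ f p :=
  (hf.contDiffAt (S.isOpen_domain.mem_nhds hp)).differentiableAt (by simp)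

lemma contDiffOn_duBar_pull (hF : IsFinsler n F) (σ : Fin m) :
    ContDiffOn ℝ ∞ (duBar σ (S.pull F)) S.domain :=
  contDiffOn_dAnti S.isOpen_domain (ofRealCLM.contDiff.comp_contDiffOn (hF.smooth S)) _

lemma contDiffOn_metricTensor (hF : IsFinsler n F) (α σ : Fin m) :
    ContDiffOn ℝ ∞ (fun q => metricTensor F S q α σ) S.domain :=
  contDiffOn_dHol S.isOpen_domain (contDiffOn_duBar_pull hF σ) _

lemma differentiableAt_metricTensor (hF : IsFinsler n F) (hp : p ∈ S.domain) (α σ : Fin m) :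
    DifferentiableAt ℝ (fun q => metricTensor F S q α σ) p :=
  differentiableAt_of_contDiffOn_domain (contDiffOn_metricTensor hF α σ) hp

lemma metricDet_ne_zero (hF : IsFinsler n F) (hp : p ∈ S.domain) : metricDet F S p ≠ 0 :=
  (hF.pseudoconvex S p hp).det_pos.ne'

lemma differentiableAt_metricDet (hF : IsFinsler n F) (hp : p ∈ S.domain) :
    DifferentiableAt ℝ (metricDet F S) p :=
  differentiableAt_det (differentiableAt_metricTensor hF hp)

lemma metricInv_mul_metricTensor (hF : IsFinsler n F) (hp : p ∈ S.domain) (σ τ : Fin m) :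
    ∑ β, metricInv F S σ β p * metricTensor F S p β τ = if σ = τ then 1 else 0 := by
  rw [← Matrix.one_apply,
    ← Matrix.nonsing_inv_mul _ (isUnit_iff_ne_zero.2 (metricDet_ne_zero hF hp)), Matrix.mul_apply]
  rfl

lemma metricTensor_mul_metricInv (hF : IsFinsler n F) (hp : p ∈ S.domain) (α β : Fin m) :
    ∑ σ, metricTensor F S p α σ * metricInv F S σ β p = if α = β then 1 else 0 := by
  rw [← Matrix.one_apply,
    ← Matrix.mul_nonsing_inv _ (isUnit_iff_ne_zero.2 (metricDet_ne_zero hF hp)), Matrix.mul_apply]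
  rfl

/-- The derivatives of `det h`. -/
lemma tangent_metricDet {D : (Pt n m → ℂ) → ℂ} (hD : IsTangentAt p D) (hF : IsFinsler n F)
    (hp : p ∈ S.domain) :
    D (metricDet F S) = metricDet F S p *
      ∑ α, ∑ σ, metricInv F S σ α p * D fun q => metricTensor F S q α σ := by
  have h0 : (metricTensor F S p).adjugate = metricDet F S p • (metricTensor F S p)⁻¹ := by
    rw [Matrix.inv_def, smul_smul, Ring.inverse_eq_inv', ← metricDet,
      mul_inv_cancel₀ (metricDet_ne_zero hF hp), one_smul]
  change D (fun q => (metricTensor F S q).det) = _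
  rw [hD.det (differentiableAt_metricTensor hF hp), h0, Matrix.smul_mul, Matrix.trace_smul,
    smul_eq_mul, Finset.sum_comm]
  rfl

lemma delta_metricDet (hF : IsFinsler n F) (hp : p ∈ S.domain) (α : Fin m) :
    delta A F S α (metricDet F S) p = metricDet F S p * ∑ β, chernL A F S β β α p :=
  tangent_metricDet (isTangentAt_delta A F S α p) hF hp

lemma du_metricDet (hF : IsFinsler n F) (hp : p ∈ S.domain) (α : Fin m) :
    du α (metricDet F S) p = metricDet F S p * ∑ β, chernC F S β β α p :=
  tangent_metricDet (isTangentAt_du p α) hF hp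

/-- `∂̇_β h_{ασ̄}` is symmetric in `α` and `β`. -/
lemma du_metricTensor_comm (hF : IsFinsler n F) (hp : p ∈ S.domain) (α β σ : Fin m) :
    du β (fun q => metricTensor F S q α σ) p = du α (fun q => metricTensor F S q β σ) p :=
  dHol_comm S.isOpen_domain (contDiffOn_duBar_pull hF σ) hp _ _

lemma chernC_comm (hF : IsFinsler n F) (hp : p ∈ S.domain) (α β γ : Fin m) :
    chernC F S γ α β p = chernC F S γ β α p := by
  simp only [chernC, du_metricTensor_comm hF hp α β]

lemma differentiableAt_dz_duBar (hF : IsFinsler n F) (hp : p ∈ S.domain) (k : Fin n) (σ : Fin m) :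
    DifferentiableAt ℝ (dz k (duBar σ (S.pull F))) p :=
  differentiableAt_of_contDiffOn_domain
    (contDiffOn_dHol S.isOpen_domain (contDiffOn_duBar_pull hF σ) _) hp

lemma differentiableAt_anchorCoeff_fst (hp : p ∈ S.domain) (k : Fin n) (α : Fin m) :
    DifferentiableAt ℝ (fun q : Pt n m => anchorCoeff A S k α q.1) p :=
  (differentiableAt_anchorCoeff A S k α hp.1).comp p differentiableAt_fst

lemma differentiableAt_dAlg_duBar (hF : IsFinsler n F) (hp : p ∈ S.domain) (α σ : Fin m) :
    DifferentiableAt ℝ (dAlg A S α (duBar σ (S.pull F))) p :=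
  DifferentiableAt.fun_sum fun k _ =>
    (differentiableAt_anchorCoeff_fst A hp k α).mul (differentiableAt_dz_duBar hF hp k σ)

/-- The anchor coefficients depend on `z` alone, so `∂̇_γ` passes through them and commutes with
`∂/∂z^k`. -/
lemma du_dAlg_duBar (hF : IsFinsler n F) (hp : p ∈ S.domain) (α γ σ : Fin m) :
    du γ (dAlg A S α (duBar σ (S.pull F))) p =
      dAlg A S α (fun q => metricTensor F S q γ σ) p := by
  have hT := isTangentAt_du p γ
  change du γ (fun q => ∑ k, anchorCoeff A S k α q.1 * dz k (duBar σ (S.pull F)) q) p = _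
  rw [hT.sum fun k _ => (differentiableAt_anchorCoeff_fst A hp k α).fun_mul
    (differentiableAt_dz_duBar hF hp k σ)]
  refine Finset.sum_congr rfl fun k _ => ?_
  rw [hT.mul (differentiableAt_anchorCoeff_fst A hp k α) (differentiableAt_dz_duBar hF hp k σ),
    du_comp_fst γ (differentiableAt_anchorCoeff A S k α hp.1), mul_zero, add_zero]
  congr 1
  exact dHol_comm S.isOpen_domain (contDiffOn_duBar_pull hF σ) hp _ _

lemma differentiableAt_nonlin (hF : IsFinsler n F) (hp : p ∈ S.domain) (β α : Fin m) :
    DifferentiableAt ℝ (nonlin A F S β α) p :=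
  DifferentiableAt.fun_sum fun σ _ =>
    (differentiableAt_inv_apply (differentiableAt_metricTensor hF hp)
      (metricDet_ne_zero hF hp) σ β).mul (differentiableAt_dAlg_duBar A hF hp α σ)

/-- The definition of `N` cleared of the inverse matrix: in this form it can be differentiated
without differentiating `h⁻¹`. -/
lemma sum_nonlin_mul_metricTensor (hF : IsFinsler n F) (hp : p ∈ S.domain) (α σ : Fin m) :
    ∑ β, nonlin A F S β α p * metricTensor F S p β σ = dAlg A S α (duBar σ (S.pull F)) p := by
  simp only [nonlin, Finset.sum_mul]
  rw [Finset.sum_comm]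
  have : ∀ τ, ∑ β, metricInv F S τ β p * dAlg A S α (duBar τ (S.pull F)) p *
      metricTensor F S p β σ =
      (if τ = σ then 1 else 0) * dAlg A S α (duBar τ (S.pull F)) p := fun τ => by
    rw [← metricInv_mul_metricTensor hF hp, Finset.sum_mul]
    exact Finset.sum_congr rfl fun β _ => by ring
  simp [this]

/-- `∂̇_γ N^β_α = L^β_{γα}` -/
lemma du_nonlin (hF : IsFinsler n F) (hp : p ∈ S.domain) (α β γ : Fin m) :
    du γ (nonlin A F S β α) p = chernL A F S β γ α p := by
  have hT := isTangentAt_du p γ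
  have h1 : ∀ σ, ∑ μ, du γ (nonlin A F S μ α) p * metricTensor F S p μ σ =
      delta A F S α (fun q => metricTensor F S q γ σ) p := fun σ => by
    -- The relation `N^μ_α h_{μσ̄} = ∂_α ∂̇_σ̄ F` holds on an open set and is differentiated along
    -- `u^γ`. The term `N^μ_α ∂̇_γ h_{μσ̄}` equals `N^μ_α ∂̇_μ h_{γσ̄}` by symmetry, and this
    -- completes `∂_α` to `δ_α`.
    have h2 := hT.congr (Filter.eventuallyEq_of_mem (S.isOpen_domain.mem_nhds hp) fun q hq =>
      sum_nonlin_mul_metricTensor A hF hq α σ)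
    rw [hT.sum fun μ _ => (differentiableAt_nonlin A hF hp μ α).fun_mul
      (differentiableAt_metricTensor hF hp μ σ), du_dAlg_duBar A hF hp] at h2
    rw [delta, ← h2, ← Finset.sum_sub_distrib]
    refine Finset.sum_congr rfl fun μ _ => ?_
    rw [hT.mul (differentiableAt_nonlin A hF hp μ α) (differentiableAt_metricTensor hF hp μ σ),
      du_metricTensor_comm hF hp μ γ σ]
    ring
  simp only [chernL, ← h1, Finset.mul_sum]
  rw [Finset.sum_comm]
  have : ∀ μ, ∑ σ, metricInv F S σ β p * (du γ (nonlin A F S μ α) p * metricTensor F S p μ σ) =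
      (if μ = β then 1 else 0) * du γ (nonlin A F S μ α) p := fun μ => by
    rw [← metricTensor_mul_metricInv hF hp, Finset.sum_mul]
    exact Finset.sum_congr rfl fun σ _ => by ring
  simp [this]

/-! ### The horizontal and vertical divergence -/

section Formulas

variable {A} (Zh : Fin m → Pt n m → ℂ)

lemma sum_smul_secX_iZ (q : Pt n m) (α : Fin m) :
    (∑ β, Zh β q • secX A F S β q) (iZ α) = Zh α q := by
  simp [secX, Pi.single_apply]

lemma sum_smul_secX_iV (q : Pt n m) (α : Fin m) :
    (∑ β, Zh β q • secX A F S β q) (iV α) = -∑ β, Zh β q * nonlin A F S α β q := by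
  simp [secX, Pi.single_apply]

lemma sum_smul_secX_inr (q : Pt n m) (c : Fin m ⊕ Fin m) :
    (∑ β, Zh β q • secX A F S β q) (.inr c) = 0 := by
  simp [secX]

lemma sum_smul_secV_iZ (q : Pt n m) (α : Fin m) :
    (∑ β, Zh β q • (secV β : Sec n m) q) (iZ α) = 0 := by
  simp [secV]

lemma sum_smul_secV_iV (q : Pt n m) (α : Fin m) :
    (∑ β, Zh β q • (secV β : Sec n m) q) (iV α) = Zh α q := by
  simp [secV, Pi.single_apply]

lemma sum_smul_secV_inr (q : Pt n m) (c : Fin m ⊕ Fin m) :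
    (∑ β, Zh β q • (secV β : Sec n m) q) (.inr c) = 0 := by
  simp [secV]

variable (A) in
/-- The horizontal divergence. -/
lemma divFn_horizontal (hF : IsFinsler n F) (hp : p ∈ S.domain)
    (hZ : ∀ α, DifferentiableAt ℝ (Zh α) p) :
    divFn A F S (fun q => ∑ α, Zh α q • secX A F S α q) p =
      ∑ α, covH A F S Zh α α p - ∑ α, Zh α p * traceL A F S α p
        - ∑ α, Zh α p * traceStruct A S α p := by
  have hN := fun β α => differentiableAt_nonlin A hF hp β α
  have h1 : ∀ α, du α (fun q => -∑ β, Zh β q * nonlin A F S α β q) p =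
      -∑ β, (Zh β p * chernL A F S α α β p + nonlin A F S α β p * du α (Zh β) p) := fun α => by
    have hT := isTangentAt_du p α
    rw [hT.neg, hT.sum fun β _ => (hZ β).fun_mul (hN α β)]
    congr 1
    exact Finset.sum_congr rfl fun β _ => by rw [hT.mul (hZ β) (hN α β), du_nonlin A hF hp]
  -- The two derivatives of `det h` combine into `Z^α δ_α (det h)`.
  have h2 : ∑ α, (Zh α p * dAlg A S α (metricDet F S) p +
      (-∑ β, Zh β p * nonlin A F S α β p) * du α (metricDet F S) p) =
      metricDet F S p * ∑ α, ∑ β, Zh α p * chernL A F S β β α p := by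
    have : ∀ α, Zh α p * delta A F S α (metricDet F S) p =
        metricDet F S p * ∑ β, Zh α p * chernL A F S β β α p := fun α => by
      rw [delta_metricDet A hF hp, ← Finset.mul_sum]
      ring
    rw [Finset.mul_sum, ← Finset.sum_congr rfl fun α _ => this α]
    simp only [delta, mul_sub, Finset.sum_sub_distrib, neg_mul, Finset.sum_mul,
      Finset.mul_sum, ← sub_eq_add_neg]
    congr 1
    rw [Finset.sum_comm]
    simp only [mul_assoc]
  rw [divFn_of_type_one_zero A F S fun q c => sum_smul_secX_inr Zh q c]
  simp only [sum_smul_secX_iZ, sum_smul_secX_iV]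
  rw [h2, mul_left_comm, mul_div_cancel_left₀ _ (metricDet_ne_zero hF hp)]
  -- After relabelling, both sides equal `δ_α Z^α + Z^α L^β_{βα} - Z^α 𝒞_α`; on the right the traces
  -- `Z^α L^β_{αβ}` cancel.
  simp only [h1, covH, delta, traceL, Finset.sum_add_distrib, Finset.sum_sub_distrib,
    Finset.sum_neg_distrib, Finset.mul_sum, mul_sub]
  rw [Finset.sum_comm (f := fun α β => Zh β p * chernL A F S α α β p),
    Finset.sum_comm (f := fun α β => nonlin A F S α β p * du α (Zh β) p),
    Finset.sum_comm (f := fun α ε => Zh ε p * chernL A F S α ε α p)]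
  simp only [← Finset.mul_sum]
  ring

variable (A) in
/-- The vertical divergence. -/
lemma divFn_vertical (hF : IsFinsler n F) (hp : p ∈ S.domain) :
    divFn A F S (fun q => ∑ α, Zh α q • secV α q) p =
      ∑ α, covV F S Zh α α p + ∑ α, Zh α p * traceC F S α p := by
  rw [divFn_of_type_one_zero A F S fun q c => sum_smul_secV_inr Zh q c]
  simp only [sum_smul_secV_iZ, sum_smul_secV_iV]
  have h0 : ∀ α, dAlg A S α (fun _ => 0) p = 0 := fun α => (isTangentAt_dAlg A S α p).const 0
  have h2 : ∑ α, (0 * dAlg A S α (metricDet F S) p + Zh α p * du α (metricDet F S) p) =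
      metricDet F S p * ∑ α, Zh α p * ∑ β, chernC F S β β α p := by
    rw [Finset.mul_sum]
    exact Finset.sum_congr rfl fun α _ => by rw [du_metricDet hF hp]; ring
  rw [h2, mul_left_comm, mul_div_cancel_left₀ _ (metricDet_ne_zero hF hp)]
  simp only [h0, covV, traceC, Finset.sum_add_distrib]
  rw [Finset.sum_comm (f := fun α ε => Zh ε p * chernC F S α ε α p)]
  simp only [← Finset.mul_sum, chernC_comm hF hp _ _ _]
  -- The two traces of `C` agree, so the factor `2` splits between the covariant derivative and
  -- `C_α`.
  have h3 : ∀ α, ∑ β, chernC F S β α β p = ∑ β, chernC F S β β α p := fun α =>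
    Finset.sum_congr rfl fun β _ => chernC_comm hF hp _ _ _
  simp [h3]
  ring

end Formulas

end ChernFinsler

/-! ### Regularity of the components in the adapted frame -/

section Components

variable {n m : ℕ}
  {M : Type*} [TopologicalSpace M] [ChartedSpace (Fin n → ℂ) M]
  [IsManifold 𝓘(ℂ, Fin n → ℂ) ω M]
  {E : M → Type*} [∀ x, AddCommGroup (E x)] [∀ x, Module ℂ (E x)] [∀ x, TopologicalSpace (E x)]
  [TopologicalSpace (TotalSpace (Fin m → ℂ) E)] [FiberBundle (Fin m → ℂ) E]
  {A : HolLieAlgebroid n m E} {F : TotalSpace (Fin m → ℂ) E → ℝ} {S : LocalSystem n m E}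
  {W : Sec n m} {Zh Zv : Fin m → Pt n m → ℂ} {p : Pt n m}

/-- The horizontal components of a smooth section are differentiable. -/
lemma differentiableAt_horizontal (hW : ContDiffOn ℝ ∞ W S.domain)
    (hdec : ∀ q ∈ S.domain, W q = ∑ α, Zh α q • secX A F S α q + ∑ α, Zv α q • secV α q)
    (hp : p ∈ S.domain) (α : Fin m) : DifferentiableAt ℝ (Zh α) p := by
  have h1 := differentiableAt_pi.1 (differentiableAt_of_contDiffOn_domain hW hp) (iZ α)
  refine h1.congr_of_eventuallyEq
    (Filter.eventuallyEq_of_mem (S.isOpen_domain.mem_nhds hp) fun q hq => ?_)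
  rw [hdec q hq, Pi.add_apply, sum_smul_secX_iZ, sum_smul_secV_iZ, add_zero]

/-- The vertical components of a smooth section are differentiable. -/
lemma differentiableAt_vertical (hF : IsFinsler n F) (hW : ContDiffOn ℝ ∞ W S.domain)
    (hdec : ∀ q ∈ S.domain, W q = ∑ α, Zh α q • secX A F S α q + ∑ α, Zv α q • secV α q)
    (hp : p ∈ S.domain) (α : Fin m) : DifferentiableAt ℝ (Zv α) p := by
  have h1 := differentiableAt_pi.1 (differentiableAt_of_contDiffOn_domain hW hp) (iV α)
  have h2 : DifferentiableAt ℝ (fun q => ∑ β, Zh β q * nonlin A F S α β q) p :=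
    DifferentiableAt.fun_sum fun β _ =>
      (differentiableAt_horizontal hW hdec hp β).mul (differentiableAt_nonlin A hF hp α β)
  -- The vertical component is `δ𝒱^α(W)`: the `𝒱_α`-component of `W` corrected by `N^α_β Z^β`.
  refine (h1.fun_add h2).congr_of_eventuallyEq
    (Filter.eventuallyEq_of_mem (S.isOpen_domain.mem_nhds hp) fun q hq => ?_)
  rw [hdec q hq, Pi.add_apply, sum_smul_secX_iV, sum_smul_secV_iV]
  ring

lemma differentiableAt_sum_smul_secX (hF : IsFinsler n F) (hp : p ∈ S.domain)
    (hZ : ∀ α, DifferentiableAt ℝ (Zh α) p) :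
    DifferentiableAt ℝ (fun q => ∑ α, Zh α q • secX A F S α q) p := by
  refine differentiableAt_pi.2 fun c => ?_
  rcases c with (α | α) | c
  · simpa only [sum_smul_secX_iZ] using hZ α
  · simp only [sum_smul_secX_iV]
    exact (DifferentiableAt.fun_sum fun β _ =>
      (hZ β).mul (differentiableAt_nonlin A hF hp α β)).neg
  · simp only [sum_smul_secX_inr]
    exact differentiableAt_const _

lemma differentiableAt_sum_smul_secV (hZ : ∀ α, DifferentiableAt ℝ (Zv α) p) :
    DifferentiableAt ℝ (fun q => ∑ α, Zv α q • (secV α : Sec n m) q) p :=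
  DifferentiableAt.fun_sum fun α _ => (hZ α).smul (differentiableAt_const _)

end Components

end FinslerAlgebroid

end

/-! ### The divergence formulas -/

theorem mainTheorem4 {n m : ℕ}
    {M : Type*} [TopologicalSpace M] [ChartedSpace (Fin n → ℂ) M]
    [IsManifold 𝓘(ℂ, Fin n → ℂ) ω M]
    {E : M → Type*} [∀ x, AddCommGroup (E x)] [∀ x, Module ℂ (E x)] [∀ x, TopologicalSpace (E x)]
    [TopologicalSpace (TotalSpace (Fin m → ℂ) E)] [FiberBundle (Fin m → ℂ) E]
    [VectorBundle ℂ (Fin m → ℂ) E]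
    [ContMDiffVectorBundle ω (Fin m → ℂ) E 𝓘(ℂ, Fin n → ℂ)]
    (A : FinslerAlgebroid.HolLieAlgebroid n m E)
    (F : TotalSpace (Fin m → ℂ) E → ℝ) (hF : FinslerAlgebroid.IsFinsler n F)
    (S : FinslerAlgebroid.LocalSystem n m E)
    (Z : ∀ q : TotalSpace (Fin m → ℂ) E, FinslerAlgebroid.prolongation A q)
    (hZ : ContDiffOn ℝ ∞ (FinslerAlgebroid.toSec S Z) S.domain)
    (Zh Zv : Fin m → FinslerAlgebroid.Pt n m → ℂ)
    (hdecomp : ∀ p ∈ S.domain, FinslerAlgebroid.toSec S Z p =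
      ∑ α, Zh α p • FinslerAlgebroid.secX A F S α p
        + ∑ α, Zv α p • FinslerAlgebroid.secV α p) :
    (∀ d : FinslerAlgebroid.Pt n m → ℂ,
      FinslerAlgebroid.IsDivergence A F S
          (fun p => ∑ α, Zh α p • FinslerAlgebroid.secX A F S α p) d ↔
        ∀ p ∈ S.domain, d p =
          ∑ α, FinslerAlgebroid.covH A F S Zh α α p
            - ∑ α, Zh α p * FinslerAlgebroid.traceL A F S α p
            - ∑ α, Zh α p * FinslerAlgebroid.traceStruct A S α p) ∧
    (∀ d : FinslerAlgebroid.Pt n m → ℂ,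
      FinslerAlgebroid.IsDivergence A F S
          (fun p => ∑ α, Zv α p • FinslerAlgebroid.secV α p) d ↔
        ∀ p ∈ S.domain, d p =
          ∑ α, FinslerAlgebroid.covV F S Zv α α p
            + ∑ α, Zv α p * FinslerAlgebroid.traceC F S α p) ∧
    (∀ d dh dv : FinslerAlgebroid.Pt n m → ℂ,
      FinslerAlgebroid.IsDivergence A F S
          (fun p => ∑ α, Zh α p • FinslerAlgebroid.secX A F S α p) dh →
      FinslerAlgebroid.IsDivergence A F S
          (fun p => ∑ α, Zv α p • FinslerAlgebroid.secV α p) dv →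
      (FinslerAlgebroid.IsDivergence A F S (FinslerAlgebroid.toSec S Z) d ↔
        ∀ p ∈ S.domain, d p = dh p + dv p)) := by
  have hdet : ∀ p ∈ S.domain, FinslerAlgebroid.metricDet F S p ≠ 0 := fun p hp =>
    FinslerAlgebroid.metricDet_ne_zero hF hp
  have hd : ∀ p ∈ S.domain, DifferentiableAt ℝ (FinslerAlgebroid.metricDet F S) p :=
    fun p hp => FinslerAlgebroid.differentiableAt_metricDet hF hp
  have hh : ∀ p ∈ S.domain, ∀ α, DifferentiableAt ℝ (Zh α) p := fun p hp =>
    FinslerAlgebroid.differentiableAt_horizontal hZ hdecomp hp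
  have hv : ∀ p ∈ S.domain, ∀ α, DifferentiableAt ℝ (Zv α) p := fun p hp =>
    FinslerAlgebroid.differentiableAt_vertical hF hZ hdecomp hp
  have hsum : ∀ p ∈ S.domain, FinslerAlgebroid.divFn A F S (FinslerAlgebroid.toSec S Z) p =
      FinslerAlgebroid.divFn A F S (fun p => ∑ α, Zh α p • FinslerAlgebroid.secX A F S α p) p +
        FinslerAlgebroid.divFn A F S (fun p => ∑ α, Zv α p • FinslerAlgebroid.secV α p) p :=
      fun p hp => by
    rw [← FinslerAlgebroid.divFn_add A F S
      (FinslerAlgebroid.differentiableAt_sum_smul_secX hF hp (hh p hp))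
      (FinslerAlgebroid.differentiableAt_sum_smul_secV (hv p hp))]
    -- The decomposition is known only on the domain; this set is open, and the divergence depends
    -- only on the germ of the section.
    exact FinslerAlgebroid.divFn_congr A F S
      (Filter.eventuallyEq_of_mem (S.isOpen_domain.mem_nhds hp) hdecomp)
  simp only [FinslerAlgebroid.isDivergence_iff A F S hdet hd]
  refine ⟨fun d => ?_, fun d => ?_, fun d dh dv h1 h2 => ?_⟩
  · exact forall₂_congr fun p hp => by rw [FinslerAlgebroid.divFn_horizontal A Zh hF hp (hh p hp)]
  · exact forall₂_congr fun p hp => by rw [FinslerAlgebroid.divFn_vertical A Zv hF hp]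
  · exact forall₂_congr fun p hp => by rw [hsum p hp, h1 p hp, h2 p hp]
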